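/- A complex Poisson algebra is a complex vector space $P$ with a Lie bracket $\{X,Y\}$ and a commutative associative (not necessarily unital) bilinear product $X\bullet Y$ such that $\{X\bullet Y,Z\}=X\bullet\{Y,Z\}+\{X,Z\}\bullet Y$. Write $\mathfrak g_P=(P,\{\,,\})$, $\mathcal A_P=(P,\bullet)$ and $X\cdot Y=\{X,Y\}+X\bullet Y$; the product $\cdot$ determines both operations, since $\{X,Y\}=\frac12(X\cdot Y-Y\cdot X)$ and $X\bullet Y=\frac12(X\cdot Y+Y\cdot X)$. The following tables (products $e_i\cdot e_j$ not listed are $0$) define 3-dimensional complex Poisson algebras with basis $e_1,e_2,e_3$: - $\mathcal P_{3,1}(\gamma)$, $\gamma\in\mathbb C$: $e_1\cdot e_2=(1+\gamma)e_3$, $e_2\cdot e_1=(-1+\gamma)e_3$; - $\mathcal P_{3,2}$: $e_1\cdot e_1=e_3$, $e_1\cdot e_2=-e_2\cdot e_1=e_3$; - $\mathcal P_{3,3}(\alpha)$, $\alpha\in\mathbb C$: $e_1\cdot e_1=\alpha^2e_3$, $e_1\cdot e_2=-e_2\cdot e_1=e_2$, $e_1\cdot e_3=e_3\cdot e_1=\alpha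 e_3$, $e_3\cdot e_3=e_3$; - $\mathcal P_{3,4}$: $e_1\cdot e_1=e_3$, $e_1\cdot e_2=-e_2\cdot e_1=e_2$; - $\mathcal P_{3,5}$: $e_1\cdot e_2=-e_2\cdot e_1=e_2$; - $\mathcal P_{3,6}$: $e_3\cdot e_3=e_3$, $e_1\cdot e_2=-e_2\cdot e_1=e_2$, $e_1\cdot e_3=e_3\cdot e_1=e_1$, $e_2\cdot e_3=e_3\cdot e_2=e_2$; - $\mathcal P_{3,7}(\alpha)$, $\alpha\in\mathbb C\setminus\{0\}$: $e_1\cdot e_2=-e_2\cdot e_1=e_2$, $e_1\cdot e_3=-e_3\cdot e_1=\alpha e_3$; - $\mathcal P_{3,8}$: $e_1\cdot e_2=-e_2\cdot e_1=e_2+e_3$, $e_1\cdot e_3=-e_3\cdot e_1=e_3$; - $\mathcal P_{3,9}$: $e_1\cdot e_2=-e_2\cdot e_1=2e_2$, $e_1\cdot e_3=-e_3\cdot e_1=-2e_3$, $e_2\cdot e_3=-e_3\cdot e_2=e_1$. Let $P$ be a 3-dimensional complex Poisson algebra. 1. If $\mathfrak g_P$ is not abelian, then $P$ is isomorphic to an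 algebra in the list, and the family $\mathcal P_{3,k}$ ($1\le k\le 9$) to which this algebra belongs is unique. (The value of the parameter within a family need not be unique.) Moreover $\mathfrak g_P$ is nilpotent, or solvable and not nilpotent, or simple. 2. $\mathfrak g_P$ is nilpotent and not abelian if and only if it is the Heisenberg algebra ($\{e_1,e_2\}=e_3$, $e_3$ central), and this holds if and only if $P\cong\mathcal P_{3,1}(\gamma)$ for some $\gamma$ or $P\cong\mathcal P_{3,2}$. 3. $\mathfrak g_P$ is solvable and not nilpotent if and only if it has a basis with $\{e_2,e_3\}=0$ and one of: (i) $\{e_1,e_2\}=e_2$, $\{e_1,e_3\}=0$; (ii) $\{e_1,e_2\}=e_2$, $\{e_1,e_3\}=\alpha e_3$ for some $\alpha\ne0$; (iii) $\{e_1,e_2\}=e_2+e_3$, $\{e_1,e_3\}=e_3$. Case (i) holds if and only if $P$ is isomorphic to $\mathcal P_{3,3}(\alpha)$ for some $\alpha$, or to $\mathcal P_{3,4}$, $\mathcal P_{3,5}$ or $\mathcal P_{3,6}$; case (ii) with a given $\alpha\neq 0$ if and only if $P\cong\mathcal P_{3,7}(\alpha)$; case (iii) if and only if $P\cong\mathcal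 P_{3,8}$. 4. $\mathfrak g_P$ is simple if and only if $\mathfrak g_P\cong\mathfrak{sl}(2,\mathbb C)$, if and only if $P\cong\mathcal P_{3,9}$. 5. If $\mathfrak g_P$ is abelian, then $X\cdot Y=X\bullet Y$ for all $X,Y$, and $P$ is isomorphic to a complex Poisson algebra $Q$ with $\mathfrak g_Q$ abelian if and only if $\mathcal A_P\cong\mathcal A_Q$. Every 3-dimensional commutative associative complex algebra $A$ (not necessarily unital) is $\mathcal A_Q$ for a Poisson algebra $Q$ on $A$ with $\mathfrak g_Q$ abelian. -/

import Mathlib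

/-- A Poisson algebra structure on a `K`-vector space `V`: a Lie bracket `{X, Y}` and a commutative
associative (not necessarily unital) product `X • Y`, both bilinear, related by the Leibniz
identity. -/
structure PoissonStructure (K V : Type*) [Field K] [AddCommGroup V] [Module K V] where
  bracket : V →ₗ[K] V →ₗ[K] V
  mul : V →ₗ[K] V →ₗ[K] V
  bracket_self : ∀ X, bracket X X = 0
  jacobi : ∀ X Y Z,
    bracket X (bracket Y Z) + bracket Y (bracket Z X) + bracket Z (bracket X Y) = 0
  mul_comm : ∀ X Y, mul X Y = mul Y X
  mul_assoc : ∀ X Y Z, mul (mul X Y) Z = mul X (mul Y Z)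
  leibniz : ∀ X Y Z, bracket (mul X Y) Z = mul X (bracket Y Z) + mul (bracket X Z) Y

set_option linter.unusedSimpArgs false
set_option linter.unusedTactic false
set_option linter.unreachableTactic false
set_option linter.unnecessarySeqFocus false

namespace PoissonStructure

section General

variable {K V W : Type*} [Field K] [AddCommGroup V] [Module K V] [AddCommGroup W] [Module K W]

/-- The product `X · Y = {X, Y} + X • Y` of the associated admissible Poisson algebra. -/
def prod (P : PoissonStructure K V) : V →ₗ[K] V →ₗ[K] V := P.bracket + P.mul

theorem bracket_skew (P : PoissonStructure K V) (X Y : V) :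
    P.bracket X Y = -P.bracket Y X := by
  have h := P.bracket_self (X + Y)
  simp only [map_add, LinearMap.add_apply, P.bracket_self, zero_add, add_zero] at h
  exact eq_neg_of_add_eq_zero_right h

/-- The Lie algebra `(V, { , })` of a Poisson algebra. -/
def LiePart (_P : PoissonStructure K V) : Type _ := V

instance (P : PoissonStructure K V) : AddCommGroup P.LiePart := inferInstanceAs (AddCommGroup V)

instance (P : PoissonStructure K V) : Module K P.LiePart := inferInstanceAs (Module K V)

instance (P : PoissonStructure K V) : LieRing P.LiePart where
  bracket X Y := P.bracket (X : V) (Y : V)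
  add_lie X Y Z := LinearMap.map_add₂ P.bracket X Y Z
  lie_add X Y Z := (P.bracket (X : V)).map_add Y Z
  lie_self X := P.bracket_self X
  leibniz_lie X Y Z := by
    change P.bracket (X : V) (P.bracket (Y : V) (Z : V)) =
      (P.bracket (P.bracket (X : V) (Y : V)) (Z : V) +
        P.bracket (Y : V) (P.bracket (X : V) (Z : V)) : V)
    have h := P.jacobi X Y Z
    rw [P.bracket_skew Z X, map_neg, P.bracket_skew Z (P.bracket X Y)] at h
    rw [← sub_eq_zero, ← h]
    abel

instance (P : PoissonStructure K V) : LieAlgebra K P.LiePart where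
  lie_smul c X Y := (P.bracket (X : V)).map_smul c Y

/-- The commutative associative algebra `(V, •)` of a Poisson algebra. -/
def AssocPart (_P : PoissonStructure K V) : Type _ := V

instance (P : PoissonStructure K V) : AddCommGroup P.AssocPart := inferInstanceAs (AddCommGroup V)

instance (P : PoissonStructure K V) : Module K P.AssocPart := inferInstanceAs (Module K V)

instance (P : PoissonStructure K V) : NonUnitalCommRing P.AssocPart where
  mul X Y := P.mul (X : V) (Y : V)
  left_distrib X Y Z := (P.mul (X : V)).map_add Y Z
  right_distrib X Y Z := LinearMap.map_add₂ P.mul X Y Z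
  zero_mul X := LinearMap.map_zero₂ P.mul X
  mul_zero X := (P.mul (X : V)).map_zero
  mul_assoc X Y Z := P.mul_assoc X Y Z
  mul_comm X Y := P.mul_comm X Y

instance (P : PoissonStructure K V) : IsScalarTower K P.AssocPart P.AssocPart where
  smul_assoc c X Y := LinearMap.map_smul₂ P.mul c X Y

instance (P : PoissonStructure K V) : SMulCommClass K P.AssocPart P.AssocPart where
  smul_comm c X Y := ((P.mul (X : V)).map_smul c Y).symm

/-- Isomorphism of Poisson algebras: a linear bijection that preserves both operations. -/
def IsIsomorphic (P : PoissonStructure K V) (Q : PoissonStructure K W) : Prop :=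
  ∃ e : V ≃ₗ[K] W, (∀ X Y, e (P.bracket X Y) = Q.bracket (e X) (e Y)) ∧
    ∀ X Y, e (P.mul X Y) = Q.mul (e X) (e Y)

end General

/-- The bilinear product on `ℂ³` with `e i · e j = c i j`. -/
def productOfTable (c : Fin 3 → Fin 3 → (Fin 3 → ℂ)) :
    (Fin 3 → ℂ) →ₗ[ℂ] (Fin 3 → ℂ) →ₗ[ℂ] (Fin 3 → ℂ) :=
  LinearMap.mk₂ ℂ (fun X Y k => ∑ i, ∑ j, X i * Y j * c i j k)
    (by intro X X' Y; ext k; simp [Fin.sum_univ_three]; ring)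
    (by intro a X Y; ext k; simp [Fin.sum_univ_three]; ring)
    (by intro X Y Y'; ext k; simp [Fin.sum_univ_three]; ring)
    (by intro a X Y; ext k; simp [Fin.sum_univ_three]; ring)

/-- The bracket `{X, Y} = (X · Y - Y · X) / 2`. -/
noncomputable def skewPart (m : (Fin 3 → ℂ) →ₗ[ℂ] (Fin 3 → ℂ) →ₗ[ℂ] (Fin 3 → ℂ)) :
    (Fin 3 → ℂ) →ₗ[ℂ] (Fin 3 → ℂ) →ₗ[ℂ] (Fin 3 → ℂ) :=
  (1 / 2 : ℂ) • (m - m.flip)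

/-- The commutative product `X • Y = (X · Y + Y · X) / 2`. -/
noncomputable def symmPart (m : (Fin 3 → ℂ) →ₗ[ℂ] (Fin 3 → ℂ) →ₗ[ℂ] (Fin 3 → ℂ)) :
    (Fin 3 → ℂ) →ₗ[ℂ] (Fin 3 → ℂ) →ₗ[ℂ] (Fin 3 → ℂ) :=
  (1 / 2 : ℂ) • (m + m.flip)

/-- The table `e i · e j = c i j` defines a Poisson algebra on `ℂ³` through
`{X, Y} = (X · Y - Y · X) / 2` and `X • Y = (X · Y + Y · X) / 2`: the Jacobi identity,
associativity of `•` and the Leibniz identity hold. -/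
def IsPoissonTable (c : Fin 3 → Fin 3 → (Fin 3 → ℂ)) : Prop :=
  (∀ X Y Z, skewPart (productOfTable c) X (skewPart (productOfTable c) Y Z)
    + skewPart (productOfTable c) Y (skewPart (productOfTable c) Z X)
    + skewPart (productOfTable c) Z (skewPart (productOfTable c) X Y) = 0) ∧
  (∀ X Y Z, symmPart (productOfTable c) (symmPart (productOfTable c) X Y) Z
    = symmPart (productOfTable c) X (symmPart (productOfTable c) Y Z)) ∧
  (∀ X Y Z, skewPart (productOfTable c) (symmPart (productOfTable c) X Y) Z
    = symmPart (productOfTable c) X (skewPart (productOfTable c) Y Z)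
      + symmPart (productOfTable c) (skewPart (productOfTable c) X Z) Y)

theorem isPoissonTable_of (c : Fin 3 → Fin 3 → (Fin 3 → ℂ))
    (b s : (Fin 3 → ℂ) → (Fin 3 → ℂ) → (Fin 3 → ℂ))
    (hb : ∀ X Y, skewPart (productOfTable c) X Y = b X Y)
    (hs : ∀ X Y, symmPart (productOfTable c) X Y = s X Y)
    (h : ∀ X Y Z, b X (b Y Z) + b Y (b Z X) + b Z (b X Y) = 0 ∧ s (s X Y) Z = s X (s Y Z) ∧
      b (s X Y) Z = s X (b Y Z) + s (b X Z) Y) : IsPoissonTable c := by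
  simp only [IsPoissonTable, hb, hs]
  exact ⟨fun X Y Z => (h X Y Z).1, fun X Y Z => (h X Y Z).2.1, fun X Y Z => (h X Y Z).2.2⟩

/-- The Poisson algebra `ℂ³` whose product `X · Y = {X, Y} + X • Y` is given by the table
`e i · e j = c i j`. -/
noncomputable def ofTable (c : Fin 3 → Fin 3 → (Fin 3 → ℂ)) (h : IsPoissonTable c) :
    PoissonStructure ℂ (Fin 3 → ℂ) where
  bracket := skewPart (productOfTable c)
  mul := symmPart (productOfTable c)
  bracket_self X := by simp [skewPart]
  jacobi := h.1
  mul_comm X Y := by simp [symmPart, add_comm]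
  mul_assoc := h.2.1
  leibniz := h.2.2

theorem prod_ofTable (c : Fin 3 → Fin 3 → (Fin 3 → ℂ)) (h : IsPoissonTable c) :
    (ofTable c h).prod = productOfTable c := by
  ext X Y k
  simp [prod, ofTable, skewPart, symmPart]
  ring

/-- `e₁` of the standard basis `e₁, e₂, e₃` of `ℂ³`. -/
def e₁ : Fin 3 → ℂ := ![1, 0, 0]

/-- `e₂` of the standard basis `e₁, e₂, e₃` of `ℂ³`. -/
def e₂ : Fin 3 → ℂ := ![0, 1, 0]

/-- `e₃` of the standard basis `e₁, e₂, e₃` of `ℂ³`. -/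
def e₃ : Fin 3 → ℂ := ![0, 0, 1]

/-- The algebra `P₃,₁(γ)`. In this and the following tables, row `i` and column `j` hold the
product `e i · e j`. -/
noncomputable def P31 (γ : ℂ) : PoissonStructure ℂ (Fin 3 → ℂ) :=
  ofTable
    ![![0, (1 + γ) • e₃, 0],
      ![(-1 + γ) • e₃, 0, 0],
      ![0, 0, 0]]
    (isPoissonTable_of _ (fun X Y => ![0, 0, X 0 * Y 1 - X 1 * Y 0])
      (fun X Y => ![0, 0, γ * (X 0 * Y 1 + X 1 * Y 0)])
      (by intro X Y; ext k; fin_cases k <;>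
        simp [skewPart, symmPart, productOfTable, Fin.sum_univ_three, e₁, e₂, e₃] <;> ring)
      (by intro X Y; ext k; fin_cases k <;>
        simp [skewPart, symmPart, productOfTable, Fin.sum_univ_three, e₁, e₂, e₃] <;> ring)
      (by intro X Y Z; refine ⟨?_, ?_, ?_⟩ <;> ext k <;> fin_cases k <;> simp <;> ring))

/-- The algebra `P₃,₂`. -/
noncomputable def P32 : PoissonStructure ℂ (Fin 3 → ℂ) :=
  ofTable
    ![![e₃, e₃, 0],
      ![-e₃, 0, 0],
      ![0, 0, 0]]
    (isPoissonTable_of _ (fun X Y => ![0, 0, X 0 * Y 1 - X 1 * Y 0])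
      (fun X Y => ![0, 0, X 0 * Y 0])
      (by intro X Y; ext k; fin_cases k <;>
        simp [skewPart, symmPart, productOfTable, Fin.sum_univ_three, e₁, e₂, e₃] <;> ring)
      (by intro X Y; ext k; fin_cases k <;>
        simp [skewPart, symmPart, productOfTable, Fin.sum_univ_three, e₁, e₂, e₃] <;> ring)
      (by intro X Y Z; refine ⟨?_, ?_, ?_⟩ <;> ext k <;> fin_cases k <;> simp <;> ring))

/-- The algebra `P₃,₃(α)`. -/
noncomputable def P33 (α : ℂ) : PoissonStructure ℂ (Fin 3 → ℂ) :=
  ofTable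
    ![![α ^ 2 • e₃, e₂, α • e₃],
      ![-e₂, 0, 0],
      ![α • e₃, 0, e₃]]
    (isPoissonTable_of _ (fun X Y => ![0, X 0 * Y 1 - X 1 * Y 0, 0])
      (fun X Y => ![0, 0, α ^ 2 * (X 0 * Y 0) + α * (X 0 * Y 2 + X 2 * Y 0) + X 2 * Y 2])
      (by intro X Y; ext k; fin_cases k <;>
        simp [skewPart, symmPart, productOfTable, Fin.sum_univ_three, e₁, e₂, e₃] <;> ring)
      (by intro X Y; ext k; fin_cases k <;>
        simp [skewPart, symmPart, productOfTable, Fin.sum_univ_three, e₁, e₂, e₃] <;> ring)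
      (by intro X Y Z; refine ⟨?_, ?_, ?_⟩ <;> ext k <;> fin_cases k <;> simp <;> ring))

/-- The algebra `P₃,₄`. -/
noncomputable def P34 : PoissonStructure ℂ (Fin 3 → ℂ) :=
  ofTable
    ![![e₃, e₂, 0],
      ![-e₂, 0, 0],
      ![0, 0, 0]]
    (isPoissonTable_of _ (fun X Y => ![0, X 0 * Y 1 - X 1 * Y 0, 0])
      (fun X Y => ![0, 0, X 0 * Y 0])
      (by intro X Y; ext k; fin_cases k <;>
        simp [skewPart, symmPart, productOfTable, Fin.sum_univ_three, e₁, e₂, e₃] <;> ring)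
      (by intro X Y; ext k; fin_cases k <;>
        simp [skewPart, symmPart, productOfTable, Fin.sum_univ_three, e₁, e₂, e₃] <;> ring)
      (by intro X Y Z; refine ⟨?_, ?_, ?_⟩ <;> ext k <;> fin_cases k <;> simp <;> ring))

/-- The algebra `P₃,₅`. -/
noncomputable def P35 : PoissonStructure ℂ (Fin 3 → ℂ) :=
  ofTable
    ![![0, e₂, 0],
      ![-e₂, 0, 0],
      ![0, 0, 0]]
    (isPoissonTable_of _ (fun X Y => ![0, X 0 * Y 1 - X 1 * Y 0, 0])
      (fun _ _ => 0)
      (by intro X Y; ext k; fin_cases k <;>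
        simp [skewPart, symmPart, productOfTable, Fin.sum_univ_three, e₁, e₂, e₃] <;> ring)
      (by intro X Y; ext k; fin_cases k <;>
        simp [skewPart, symmPart, productOfTable, Fin.sum_univ_three, e₁, e₂, e₃] <;> ring)
      (by intro X Y Z; refine ⟨?_, ?_, ?_⟩ <;> ext k <;> fin_cases k <;> simp <;> ring))

/-- The algebra `P₃,₆`. -/
noncomputable def P36 : PoissonStructure ℂ (Fin 3 → ℂ) :=
  ofTable
    ![![0, e₂, e₁],
      ![-e₂, 0, e₂],
      ![e₁, e₂, e₃]]
    (isPoissonTable_of _ (fun X Y => ![0, X 0 * Y 1 - X 1 * Y 0, 0])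
      (fun X Y => ![X 0 * Y 2 + X 2 * Y 0, X 1 * Y 2 + X 2 * Y 1, X 2 * Y 2])
      (by intro X Y; ext k; fin_cases k <;>
        simp [skewPart, symmPart, productOfTable, Fin.sum_univ_three, e₁, e₂, e₃] <;> ring)
      (by intro X Y; ext k; fin_cases k <;>
        simp [skewPart, symmPart, productOfTable, Fin.sum_univ_three, e₁, e₂, e₃] <;> ring)
      (by intro X Y Z; refine ⟨?_, ?_, ?_⟩ <;> ext k <;> fin_cases k <;> simp <;> ring))

/-- The algebra `P₃,₇(α)`. -/
noncomputable def P37 (α : ℂ) : PoissonStructure ℂ (Fin 3 → ℂ) :=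
  ofTable
    ![![0, e₂, α • e₃],
      ![-e₂, 0, 0],
      ![-(α • e₃), 0, 0]]
    (isPoissonTable_of _ (fun X Y => ![0, X 0 * Y 1 - X 1 * Y 0, α * (X 0 * Y 2 - X 2 * Y 0)])
      (fun _ _ => 0)
      (by intro X Y; ext k; fin_cases k <;>
        simp [skewPart, symmPart, productOfTable, Fin.sum_univ_three, e₁, e₂, e₃] <;> ring)
      (by intro X Y; ext k; fin_cases k <;>
        simp [skewPart, symmPart, productOfTable, Fin.sum_univ_three, e₁, e₂, e₃] <;> ring)
      (by intro X Y Z; refine ⟨?_, ?_, ?_⟩ <;> ext k <;> fin_cases k <;> simp <;> ring))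

/-- The algebra `P₃,₈`. -/
noncomputable def P38 : PoissonStructure ℂ (Fin 3 → ℂ) :=
  ofTable
    ![![0, e₂ + e₃, e₃],
      ![-(e₂ + e₃), 0, 0],
      ![-e₃, 0, 0]]
    (isPoissonTable_of _ (fun X Y => ![0, X 0 * Y 1 - X 1 * Y 0, (X 0 * Y 1 - X 1 * Y 0) + (X 0 * Y 2 - X 2 * Y 0)])
      (fun _ _ => 0)
      (by intro X Y; ext k; fin_cases k <;>
        simp [skewPart, symmPart, productOfTable, Fin.sum_univ_three, e₁, e₂, e₃] <;> ring)
      (by intro X Y; ext k; fin_cases k <;>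
        simp [skewPart, symmPart, productOfTable, Fin.sum_univ_three, e₁, e₂, e₃] <;> ring)
      (by intro X Y Z; refine ⟨?_, ?_, ?_⟩ <;> ext k <;> fin_cases k <;> simp <;> ring))

/-- The algebra `P₃,₉`. -/
noncomputable def P39 : PoissonStructure ℂ (Fin 3 → ℂ) :=
  ofTable
    ![![0, (2 : ℂ) • e₂, -((2 : ℂ) • e₃)],
      ![-((2 : ℂ) • e₂), 0, e₁],
      ![(2 : ℂ) • e₃, -e₁, 0]]
    (isPoissonTable_of _ (fun X Y => ![X 1 * Y 2 - X 2 * Y 1, 2 * (X 0 * Y 1 - X 1 * Y 0), -2 * (X 0 * Y 2 - X 2 * Y 0)])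
      (fun _ _ => 0)
      (by intro X Y; ext k; fin_cases k <;>
        simp [skewPart, symmPart, productOfTable, Fin.sum_univ_three, e₁, e₂, e₃] <;> ring)
      (by intro X Y; ext k; fin_cases k <;>
        simp [skewPart, symmPart, productOfTable, Fin.sum_univ_three, e₁, e₂, e₃] <;> ring)
      (by intro X Y Z; refine ⟨?_, ?_, ?_⟩ <;> ext k <;> fin_cases k <;> simp <;> ring))

/-- The nine families of the list; `family k` is the set of the algebras `P₃,ₖ₊₁`, with all the
values of the parameter where there is one (every nonzero value in the case of `P₃,₇`). -/
noncomputable def family : Fin 9 → Set (PoissonStructure ℂ (Fin 3 → ℂ)) :=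
  ![Set.range P31, {P32}, Set.range P33, {P34}, {P35}, {P36}, P37 '' {α | α ≠ 0}, {P38}, {P39}]

end PoissonStructure

/-- `L` has a basis `e₁, e₂, e₃` with `⁅e₁, e₂⁆ = x`, `⁅e₁, e₃⁆ = y`, `⁅e₂, e₃⁆ = 0`, where
`x = x₂ e₂ + x₃ e₃` and `y = y₂ e₂ + y₃ e₃`. -/
def HasBasisWithBrackets (L : Type*) [LieRing L] [LieAlgebra ℂ L] (x₂ x₃ y₂ y₃ : ℂ) : Prop :=
  ∃ b : Module.Basis (Fin 3) ℂ L,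
    ⁅b 0, b 1⁆ = x₂ • b 1 + x₃ • b 2 ∧ ⁅b 0, b 2⁆ = y₂ • b 1 + y₃ • b 2 ∧ ⁅b 1, b 2⁆ = 0

/-- The Heisenberg algebra: `⁅e₁, e₂⁆ = e₃`, and `e₃` is central. -/
def IsHeisenberg (L : Type*) [LieRing L] [LieAlgebra ℂ L] : Prop :=
  HasBasisWithBrackets L 0 1 0 0

/-! ### Bases of a three-dimensional space and coordinate comparison. -/

section LinearAlgebra

variable {V : Type*} [AddCommGroup V] [Module ℂ V]

/-! The Lie algebra is classified first, and then the commutative products compatible with each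
bracket.

For a non-abelian bracket the question is whether some `x`, `y` satisfy `⁅x, y⁆ = y ≠ 0`. If so,
complete `x`, `y` to a basis; the Jacobi identity leaves either an `sl(2)` basis or a
two-dimensional abelian ideal. On the ideal the third basis vector acts by a 2 × 2 matrix, and its
Jordan form, up to scaling, gives the solvable types. If no such pair exists, no `ad x` has a
nonzero eigenvalue, and the algebra is Heisenberg. This is `lie_classification`; the statements on
nilpotent, solvable and simple Lie parts follow by checking each type.

The Leibniz identity says that every `{ · , Z}` is a derivation of the product. In coordinates this
is a linear system in the structure constants of the product, supplemented where needed by a few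
associativity equations. For `sl(2)` and for the solvable types without center it forces the product
to vanish (`mul_eq_zero_of_sl2`, `mul_eq_zero_of_solvable`). For Heisenberg it leaves a symmetric
bilinear form on the quotient by the center, with values in the center (`exists_mul_of_heisenberg`).
For the type (i) it leaves five parameters with four quadratic relations (`exists_mul_of_affine`).
Normalising these data by a change of basis gives the tables.

The families are pairwise disjoint because `FamilyProperty` attaches to each a conjunction of
isomorphism invariants incompatible with all the others. With zero bracket only the product remains,
so the abelian case is immediate. -/

theorem exists_basis_of_det_ne_zero (b : Module.Basis (Fin 3) ℂ V)
    (M : Matrix (Fin 3) (Fin 3) ℂ) (hM : M.det ≠ 0) :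
    ∃ b' : Module.Basis (Fin 3) ℂ V,
      ∀ i, b' i = M i 0 • b 0 + M i 1 • b 1 + M i 2 • b 2 := by
  have hli : LinearIndependent ℂ M.row :=
    Matrix.linearIndependent_rows_iff_isUnit.2 ((Matrix.isUnit_iff_isUnit_det M).2 hM.isUnit)
  refine ⟨(basisOfLinearIndependentOfCardEqFinrank hli (by simp)).map b.equivFun.symm, fun i => ?_⟩
  simp [Module.Basis.equivFun_symm_apply, Fin.sum_univ_three]

theorem exists_basis_of_vectors (b : Module.Basis (Fin 3) ℂ V)
    (a₀ a₁ a₂ c₀ c₁ c₂ d₀ d₁ d₂ : ℂ)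
    (h : a₀ * c₁ * d₂ - a₀ * c₂ * d₁ - a₁ * c₀ * d₂ + a₁ * c₂ * d₀ + a₂ * c₀ * d₁
      - a₂ * c₁ * d₀ ≠ 0) :
    ∃ b' : Module.Basis (Fin 3) ℂ V,
      b' 0 = a₀ • b 0 + a₁ • b 1 + a₂ • b 2 ∧ b' 1 = c₀ • b 0 + c₁ • b 1 + c₂ • b 2 ∧
        b' 2 = d₀ • b 0 + d₁ • b 1 + d₂ • b 2 := by
  obtain ⟨b', hb'⟩ := exists_basis_of_det_ne_zero b !![a₀, a₁, a₂; c₀, c₁, c₂; d₀, d₁, d₂]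
    (by simpa [Matrix.det_fin_three] using h)
  exact ⟨b', by simpa using hb' 0, by simpa using hb' 1, by simpa using hb' 2⟩

theorem basis_expand (b : Module.Basis (Fin 3) ℂ V) (x : V) :
    ∃ a₀ a₁ a₂ : ℂ, x = a₀ • b 0 + a₁ • b 1 + a₂ • b 2 :=
  ⟨b.repr x 0, b.repr x 1, b.repr x 2, by
    conv_lhs => rw [← b.sum_repr x, Fin.sum_univ_three]⟩

theorem basis_comb_inj (b : Module.Basis (Fin 3) ℂ V) {a₀ a₁ a₂ c₀ c₁ c₂ : ℂ}
    (h : a₀ • b 0 + a₁ • b 1 + a₂ • b 2 = c₀ • b 0 + c₁ • b 1 + c₂ • b 2) :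
    a₀ = c₀ ∧ a₁ = c₁ ∧ a₂ = c₂ := by
  have h' := fun i => congrArg (fun v => b.repr v i) h
  exact ⟨by simpa [Finsupp.single_apply] using h' 0, by simpa [Finsupp.single_apply] using h' 1,
    by simpa [Finsupp.single_apply] using h' 2⟩

theorem basis_comb_eq_zero (b : Module.Basis (Fin 3) ℂ V) {a₀ a₁ a₂ : ℂ}
    (h : a₀ • b 0 + a₁ • b 1 + a₂ • b 2 = 0) : a₀ = 0 ∧ a₁ = 0 ∧ a₂ = 0 :=
  basis_comb_inj b (by simpa using h)

theorem exists_basis_of_linearIndependent (hV : Module.finrank ℂ V = 3) (x y z : V)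
    (h : ∀ a b c : ℂ, a • x + b • y + c • z = 0 → a = 0 ∧ b = 0 ∧ c = 0) :
    ∃ b : Module.Basis (Fin 3) ℂ V, b 0 = x ∧ b 1 = y ∧ b 2 = z := by
  have hli : LinearIndependent ℂ ![x, y, z] := by
    rw [Fintype.linearIndependent_iff]
    intro g hg
    obtain ⟨h0, h1, h2⟩ := h (g 0) (g 1) (g 2) (by simpa [Fin.sum_univ_three] using hg)
    intro i
    fin_cases i <;> assumption
  refine ⟨basisOfLinearIndependentOfCardEqFinrank hli (by simp [hV]), ?_, ?_, ?_⟩ <;> simp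

theorem exists_basis_of_pair (hV : Module.finrank ℂ V = 3) (x y : V)
    (h : ∀ a b : ℂ, a • x + b • y = 0 → a = 0 ∧ b = 0) :
    ∃ b : Module.Basis (Fin 3) ℂ V, b 0 = x ∧ b 1 = y := by
  have : FiniteDimensional ℂ V := Module.finite_of_finrank_eq_succ hV
  have hlt : Module.finrank ℂ (Submodule.span ℂ (Set.range ![x, y])) < 3 :=
    (finrank_range_le_card (R := ℂ) ![x, y]).trans_lt (by simp)
  have hne : Submodule.span ℂ (Set.range ![x, y]) ≠ ⊤ := by
    intro htop
    rw [htop, finrank_top, hV] at hlt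
    exact lt_irrefl _ hlt
  obtain ⟨z, hz⟩ : ∃ z, z ∉ Submodule.span ℂ (Set.range ![x, y]) := by
    by_contra! hcon
    exact hne (eq_top_iff.2 fun z _ => hcon z)
  obtain ⟨b, hb0, hb1, -⟩ := exists_basis_of_linearIndependent hV x y z (by
    intro p q r hpqr
    have hr : r = 0 := by
      by_contra hr
      apply hz
      have hx : x ∈ Submodule.span ℂ (Set.range ![x, y]) := Submodule.subset_span ⟨0, rfl⟩
      have hy : y ∈ Submodule.span ℂ (Set.range ![x, y]) := Submodule.subset_span ⟨1, rfl⟩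
      have : z = (-(p / r)) • x + (-(q / r)) • y := by
        have h1 : r • z = -(p • x + q • y) := by
          rw [eq_neg_iff_add_eq_zero, ← hpqr]; abel
        rw [← inv_smul_smul₀ hr z, h1]
        match_scalars <;> field_simp
      rw [this]
      exact add_mem (Submodule.smul_mem _ _ hx) (Submodule.smul_mem _ _ hy)
    subst hr
    obtain ⟨hp, hq⟩ := h p q (by simpa using hpqr)
    exact ⟨hp, hq, rfl⟩)
  exact ⟨b, hb0, hb1⟩

end LinearAlgebra

theorem Complex.exists_quadratic_root (p q : ℂ) : ∃ t : ℂ, t ^ 2 + p * t + q = 0 := by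
  obtain ⟨d, hd⟩ := IsAlgClosed.exists_pow_nat_eq (p ^ 2 - 4 * q) (n := 2) (by norm_num)
  exact ⟨(-p + d) / 2, by linear_combination hd / 4⟩

/-- `L` has a basis `h, e, f` with the bracket relations of `sl(2, ℂ)`. -/
def HasSl2Basis (L : Type*) [LieRing L] [LieAlgebra ℂ L] : Prop :=
  ∃ b : Module.Basis (Fin 3) ℂ L,
    ⁅b 0, b 1⁆ = (2 : ℂ) • b 1 ∧ ⁅b 0, b 2⁆ = (-2 : ℂ) • b 2 ∧ ⁅b 1, b 2⁆ = b 0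

/-! ### Classification of three-dimensional complex Lie algebras. -/

section Classification

variable {L : Type*} [LieRing L] [LieAlgebra ℂ L]

theorem isLieAbelian_of_basis (b : Module.Basis (Fin 3) ℂ L) (h01 : ⁅b 0, b 1⁆ = 0)
    (h02 : ⁅b 0, b 2⁆ = 0) (h12 : ⁅b 1, b 2⁆ = 0) : IsLieAbelian L := by
  have h10 : ⁅b 1, b 0⁆ = 0 := by rw [← lie_skew, h01, neg_zero]
  have h20 : ⁅b 2, b 0⁆ = 0 := by rw [← lie_skew, h02, neg_zero]
  have h21 : ⁅b 2, b 1⁆ = 0 := by rw [← lie_skew, h12, neg_zero]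
  refine ⟨fun x y => ?_⟩
  obtain ⟨x₀, x₁, x₂, rfl⟩ := basis_expand b x
  obtain ⟨y₀, y₁, y₂, rfl⟩ := basis_expand b y
  simp [h01, h02, h12, h10, h20, h21]

/-- The action of `b 0` on the ideal is triangular with eigenvalues `l` and `m`. Rescaling `b 0`
normalises a nonzero eigenvalue to 1. The cases are nilpotent action, exactly one zero eigenvalue,
equal nonzero eigenvalues (scalar or Jordan block), and distinct nonzero eigenvalues. -/
theorem classification_of_triangular (b : Module.Basis (Fin 3) ℂ L) {l m n : ℂ}
    (h01 : ⁅b 0, b 1⁆ = l • b 1) (h02 : ⁅b 0, b 2⁆ = n • b 1 + m • b 2) (h12 : ⁅b 1, b 2⁆ = 0)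
    (hL : ¬ IsLieAbelian L) :
    IsHeisenberg L ∨ HasBasisWithBrackets L 1 0 0 0 ∨
      (∃ α : ℂ, α ≠ 0 ∧ HasBasisWithBrackets L 1 0 0 α) ∨ HasBasisWithBrackets L 1 1 0 1 := by
  have h21 : ⁅b 2, b 1⁆ = 0 := by rw [← lie_skew, h12, neg_zero]
  by_cases hl : l = 0
  · subst hl
    by_cases hm : m = 0
    · subst hm
      by_cases hn : n = 0
      · subst hn
        exact absurd (isLieAbelian_of_basis b (by simp [h01]) (by simp [h02]) h12) hL
      · left
        obtain ⟨b', h0, h1, h2⟩ := exists_basis_of_vectors b 1 0 0 0 0 1 0 n 0 (by simpa using hn)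
        refine ⟨b', ?_, ?_, ?_⟩ <;> simp [h0, h1, h2, h01, h02, h12, h21]
    · right; left
      -- The second vector is the eigenvector for `m`, and the third is `b 1`, which is central
      -- here.
      obtain ⟨b', h0, h1, h2⟩ := exists_basis_of_vectors b m⁻¹ 0 0 0 (n / m) 1 0 1 0
        (by simpa using hm)
      refine ⟨b', ?_, ?_, ?_⟩ <;> simp [h0, h1, h2, h01, h02, h12, h21]
      match_scalars <;> field_simp
  · by_cases hml : m = l
    · subst hml
      by_cases hn : n = 0
      · subst hn
        right; right; left
        obtain ⟨b', h0, h1, h2⟩ := exists_basis_of_vectors b m⁻¹ 0 0 0 1 0 0 0 1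
          (by simpa using hl)
        refine ⟨1, one_ne_zero, b', ?_, ?_, ?_⟩ <;> simp [h0, h1, h2, h01, h02, h12, h21, hl]
      · right; right; right
        obtain ⟨b', h0, h1, h2⟩ := exists_basis_of_vectors b m⁻¹ 0 0 0 0 1 0 (n / m) 0
          (by simp [hl, hn])
        refine ⟨b', ?_, ?_, ?_⟩ <;> simp [h0, h1, h2, h01, h02, h12, h21, hl]
        all_goals match_scalars <;> field_simp
    · have hd : m - l ≠ 0 := sub_ne_zero.2 hml
      -- Distinct eigenvalues: `(n / (m - l)) • b 1 + b 2` is an eigenvector for `m`, and dividing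
      -- `b 0` by `l` turns the eigenvalues into 1 and `m / l`.
      have key : HasBasisWithBrackets L 1 0 0 (m / l) := by
        obtain ⟨b', h0, h1, h2⟩ := exists_basis_of_vectors b l⁻¹ 0 0 0 1 0 0 (n / (m - l)) 1
          (by simpa using hl)
        refine ⟨b', ?_, ?_, ?_⟩ <;> simp [h0, h1, h2, h01, h02, h12, h21, hl]
        all_goals match_scalars <;> field_simp <;> ring
      by_cases hm : m = 0
      · right; left
        simpa [hm] using key
      · exact Or.inr (Or.inr (Or.inl ⟨m / l, div_ne_zero hm hl, key⟩))

theorem classification_of_abelian_ideal (b : Module.Basis (Fin 3) ℂ L) {p q r s : ℂ}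
    (h01 : ⁅b 0, b 1⁆ = p • b 1 + q • b 2) (h02 : ⁅b 0, b 2⁆ = r • b 1 + s • b 2)
    (h12 : ⁅b 1, b 2⁆ = 0) (hL : ¬ IsLieAbelian L) :
    IsHeisenberg L ∨ HasBasisWithBrackets L 1 0 0 0 ∨
      (∃ α : ℂ, α ≠ 0 ∧ HasBasisWithBrackets L 1 0 0 α) ∨ HasBasisWithBrackets L 1 1 0 1 := by
  have h21 : ⁅b 2, b 1⁆ = 0 := by rw [← lie_skew, h12, neg_zero]
  by_cases hq : q = 0
  · exact classification_of_triangular b (by simpa [hq] using h01) h02 h12 hL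
  -- The quadratic says that `t • b 1 + q • b 2` is an eigenvector of `ad (b 0)`, with eigenvalue `t
  -- + s`. Taking it as the second basis vector and `b 1` as the third makes the action triangular.
  · obtain ⟨t, ht⟩ := Complex.exists_quadratic_root (s - p) (-(q * r))
    obtain ⟨b', h0, h1, h2⟩ := exists_basis_of_vectors b 1 0 0 0 t q 0 1 0 (by simpa using hq)
    refine classification_of_triangular b' (l := t + s) (n := 1) (m := p - t) ?_ ?_ ?_ hL
    · simp [h0, h1, h01, h02]
      match_scalars
      · linear_combination -ht
      · ring
    · simp [h0, h1, h2, h01]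
      module
    · simp [h1, h2, h21]

/-- With `⁅b 0, b 1⁆ = b 1`, the Jacobi identity on the basis gives `r = 0`, `a = c * q` and `(1 +
c) * p = 0`. So either `p = 0`, which produces an abelian ideal, or `c = -1`, which produces
`sl(2)`. -/
theorem classification_of_eigenvector (hV : Module.finrank ℂ L = 3) {x y : L}
    (hxy : ⁅x, y⁆ = y) (hy : y ≠ 0) (hL : ¬ IsLieAbelian L) :
    (IsHeisenberg L ∨ HasBasisWithBrackets L 1 0 0 0 ∨
      (∃ α : ℂ, α ≠ 0 ∧ HasBasisWithBrackets L 1 0 0 α) ∨ HasBasisWithBrackets L 1 1 0 1) ∨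
      HasSl2Basis L := by
  obtain ⟨b, rfl, rfl⟩ := exists_basis_of_pair hV x y (by
    intro u v huv
    have h1 : v • y = 0 := by simpa [hxy] using congrArg (fun w => ⁅x, w⁆) huv
    have hv : v = 0 := (smul_eq_zero.1 h1).resolve_right hy
    have h2 : u • y = 0 := by simpa [hxy] using congrArg (fun w => ⁅w, y⁆) huv
    exact ⟨(smul_eq_zero.1 h2).resolve_right hy, hv⟩)
  obtain ⟨a, d, c, h02⟩ := basis_expand b ⁅b 0, b 2⁆
  obtain ⟨p, q, r, h12⟩ := basis_expand b ⁅b 1, b 2⁆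
  have h10 : ⁅b 1, b 0⁆ = -b 1 := by rw [← lie_skew, hxy]
  have h20 : ⁅b 2, b 0⁆ = -(a • b 0 + d • b 1 + c • b 2) := by rw [← lie_skew, h02]
  have h21 : ⁅b 2, b 1⁆ = -(p • b 0 + q • b 1 + r • b 2) := by rw [← lie_skew, h12]
  have hJ := leibniz_lie (b 0) (b 1) (b 2)
  simp only [h02, h12, hxy, h10, lie_add, lie_smul, lie_self] at hJ
  obtain ⟨e0, e1, e2⟩ := basis_comb_inj b
    (a₀ := r * a) (a₁ := q + r * d) (a₂ := r * c)
    (c₀ := (1 + c) * p) (c₁ := (1 + c) * q - a) (c₂ := (1 + c) * r) (by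
      refine Eq.trans ?_ (hJ.trans ?_) <;> module)
  have hr : r = 0 := by linear_combination -e2
  subst hr
  have ha : a = c * q := by linear_combination e1
  subst ha
  by_cases hp : p = 0
  · subst hp
    left
    -- Adding `q • b 0` to `b 2` makes it commute with `b 1`.
    obtain ⟨b', h0, h1, h2⟩ := exists_basis_of_vectors b 1 0 0 0 1 0 q 0 1 (by simp)
    refine classification_of_abelian_ideal b' (p := 1) (q := 0) (r := d) (s := c) ?_ ?_ ?_ hL
    · simp [h0, h1, hxy]
    · simp [h0, h1, h2, h02]
      module
    · simp [h1, h2, h12, h10]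
  · right
    have hc : c = -1 := by
      have : (1 + c) * p = 0 := by linear_combination -e0
      linear_combination (mul_eq_zero.1 this).resolve_right hp
    subst hc
    -- Here `h = 2 • b 0` and `e = b 1`. The combination `q • b 0 - (d / 2) • b 1 + b 2` has
    -- eigenvalue -1 under `ad (b 0)`, and the factor `2 / p` gives `⁅e, f⁆ = h`.
    obtain ⟨b', h0, h1, h2⟩ := exists_basis_of_vectors b 2 0 0 0 1 0
      (2 / p * q) (2 / p * (-d / 2)) (2 / p) (by simpa using hp)
    refine ⟨b', ?_, ?_, ?_⟩
    · simp [h0, h1, hxy]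
    · simp [h0, h2, h02, hxy]
      match_scalars <;> field_simp <;> ring
    · simp [h0, h1, h2, h12, h10]
      match_scalars <;> field_simp <;> ring

theorem exists_eigenvector_of_lie_eq_smul {x y : L} {c : ℂ} (h : ⁅x, y⁆ = c • y) (hc : c ≠ 0)
    (hy : y ≠ 0) : ∃ x y : L, ⁅x, y⁆ = y ∧ y ≠ 0 :=
  ⟨c⁻¹ • x, y, by simp [h, hc], hy⟩

/-- No `ad x` has a nonzero eigenvalue. This makes `x`, `y`, `⁅x, y⁆` independent as soon as `⁅x, y⁆
≠ 0`, and then forces `⁅x, y⁆` to be central. -/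
theorem isHeisenberg_of_no_eigenvector (hV : Module.finrank ℂ L = 3)
    (hE : ¬ ∃ x y : L, ⁅x, y⁆ = y ∧ y ≠ 0) (hL : ¬ IsLieAbelian L) : IsHeisenberg L := by
  have hE' : ∀ (x y : L) (c : ℂ), ⁅x, y⁆ = c • y → y ≠ 0 → c = 0 := by
    intro x y c h hy
    by_contra hc
    exact hE (exists_eigenvector_of_lie_eq_smul h hc hy)
  have hzero : ∀ b : Module.Basis (Fin 3) ℂ L, ⁅b 0, b 1⁆ = b 2 → ⁅b 0, b 2⁆ = 0 := by
    intro b h01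
    obtain ⟨a, d, c, h02⟩ := basis_expand b ⁅b 0, b 2⁆
    -- Modulo `b 0`, `ad (b 0)` is a companion matrix with this characteristic polynomial. The term
    -- `(a / t) • b 0` lifts an eigenvector of the quotient for `t ≠ 0` to the whole space.
    have hroot : ∀ t : ℂ, t ^ 2 + (-c) * t + (-d) = 0 → t = 0 := by
      intro t ht
      by_contra ht0
      refine ht0 (hE' (b 0) ((a / t) • b 0 + (t - c) • b 1 + (1 : ℂ) • b 2) t ?_ ?_)
      · simp [h01, h02]
        match_scalars
        · ring
        · field_simp
        · linear_combination -ht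
      · intro h0
        exact one_ne_zero (basis_comb_eq_zero b h0).2.2
    have hd : d = 0 := by
      obtain ⟨t, ht⟩ := Complex.exists_quadratic_root (-c) (-d)
      have := hroot t ht
      subst this
      linear_combination -ht
    subst hd
    have hc : c = 0 := hroot c (by ring)
    subst hc
    have ha : -a = 0 := hE' (b 2) (b 0) (-a) (by rw [← lie_skew, h02]; module) (b.ne_zero 0)
    rw [h02, neg_eq_zero.1 ha]
    simp
  obtain ⟨x, y, hxy⟩ : ∃ x y : L, ⁅x, y⁆ ≠ 0 := by
    by_contra! hcon
    exact hL ⟨hcon⟩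
  have hx : x ≠ 0 := by rintro rfl; simp at hxy
  have hy : y ≠ 0 := by rintro rfl; simp at hxy
  have key : ∀ u v : ℂ, ⁅x, y⁆ = u • x + v • y → False := by
    intro u v h
    -- If `⁅x, y⁆ = u • x + v • y`, then `ad x` multiplies `⁅x, y⁆` by `v`. Once `v = 0`, the vector
    -- `x` is an eigenvector of `ad y` for `-u`.
    have hv : v = 0 := hE' x ⁅x, y⁆ v (by
      conv_lhs => rw [h]
      simp) hxy
    subst hv
    have hu : -u = 0 := hE' y x (-u) (by rw [← lie_skew, h]; module) hx
    rw [neg_eq_zero] at hu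
    subst hu
    simp [h] at hxy
  obtain ⟨b, h0, h1, h2⟩ := exists_basis_of_linearIndependent hV x y ⁅x, y⁆ (by
    intro u v w h
    have hw : w = 0 := by
      by_contra hw
      apply key (-(u / w)) (-(v / w))
      have h1 : w • ⁅x, y⁆ = -(u • x + v • y) := by
        rw [eq_neg_iff_add_eq_zero, ← h]; abel
      rw [← inv_smul_smul₀ hw ⁅x, y⁆, h1]
      match_scalars <;> field_simp
    subst hw
    have e1 : u • ⁅x, y⁆ = 0 := by simpa using congrArg (fun z => ⁅z, y⁆) h
    have e2 : v • ⁅x, y⁆ = 0 := by simpa using congrArg (fun z => ⁅x, z⁆) h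
    exact ⟨(smul_eq_zero.1 e1).resolve_right hxy, (smul_eq_zero.1 e2).resolve_right hxy, rfl⟩)
  have h01 : ⁅b 0, b 1⁆ = b 2 := by rw [h0, h1, h2]
  have h02 := hzero b h01
  -- The rotated basis `b 1, -b 0, b 2` satisfies the same relation, so `hzero` applies to it as
  -- well.
  obtain ⟨b', k0, k1, k2⟩ := exists_basis_of_vectors b 0 1 0 (-1) 0 0 0 0 1 (by simp)
  have h12 : ⁅b 1, b 2⁆ = 0 := by
    have h10 : ⁅b 1, b 0⁆ = -b 2 := by rw [← lie_skew, h01]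
    have := hzero b' (by simp [k0, k1, k2, h10])
    simpa [k0, k2] using this
  exact ⟨b, by simp [h01], by simp [h02], h12⟩

theorem lie_classification (hV : Module.finrank ℂ L = 3) (hL : ¬ IsLieAbelian L) :
    (IsHeisenberg L ∨ HasBasisWithBrackets L 1 0 0 0 ∨
      (∃ α : ℂ, α ≠ 0 ∧ HasBasisWithBrackets L 1 0 0 α) ∨ HasBasisWithBrackets L 1 1 0 1) ∨
      HasSl2Basis L := by
  by_cases hE : ∃ x y : L, ⁅x, y⁆ = y ∧ y ≠ 0
  · obtain ⟨x, y, hxy, hy⟩ := hE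
    exact classification_of_eigenvector hV hxy hy hL
  · exact Or.inl (Or.inl (isHeisenberg_of_no_eigenvector hV hE hL))

end Classification

/-! ### Nilpotency, solvability and simplicity of the types. -/

section LieTypes

variable {L : Type*} [LieRing L] [LieAlgebra ℂ L]

theorem isNilpotent_of_triple_lie_eq_zero (h : ∀ x y z : L, ⁅x, ⁅y, z⁆⁆ = 0) :
    LieRing.IsNilpotent L := by
  refine LieModule.IsNilpotent.mk (R := ℂ) (L := L) (M := L) (k := 2) ?_
  rw [LieModule.lowerCentralSeries_succ, LieModule.lowerCentralSeries_succ,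
    LieModule.lowerCentralSeries_zero, LieSubmodule.lie_eq_bot_iff]
  intro x _ m hm
  have hle : ⁅(⊤ : LieIdeal ℂ L), (⊤ : LieSubmodule ℂ L L)⁆ ≤
      LieModule.maxTrivSubmodule ℂ L L := by
    rw [LieSubmodule.lieIdeal_oper_eq_span, LieSubmodule.lieSpan_le]
    rintro _ ⟨y, z, rfl⟩
    exact fun w => h w y z
  exact hle hm x

theorem isSolvable_of_lie_lie_lie_eq_zero (h : ∀ x y z w : L, ⁅⁅x, y⁆, ⁅z, w⁆⁆ = 0) :
    LieAlgebra.IsSolvable L := by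
  refine LieAlgebra.IsSolvable.mk (R := ℂ) (k := 2) ?_
  rw [LieAlgebra.derivedSeries_def, LieAlgebra.derivedSeriesOfIdeal_succ,
    LieAlgebra.derivedSeriesOfIdeal_succ, LieAlgebra.derivedSeriesOfIdeal_zero,
    LieSubmodule.lie_eq_bot_iff]
  intro x hx y hy
  rw [← LieSubmodule.mem_toSubmodule, LieSubmodule.lieIdeal_oper_eq_linear_span] at hx hy
  induction hx using Submodule.span_induction with
  | mem x hx =>
    obtain ⟨a, c, rfl⟩ := hx
    induction hy using Submodule.span_induction with
    | mem y hy =>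
      obtain ⟨a', c', rfl⟩ := hy
      exact h _ _ _ _
    | zero => simp
    | add u v _ _ hu hv => rw [lie_add, hu, hv, add_zero]
    | smul t u _ hu => rw [lie_smul, hu, smul_zero]
  | zero => simp
  | add u v _ _ hu hv => rw [add_lie, hu, hv, add_zero]
  | smul t u _ hu => rw [smul_lie, hu, smul_zero]

/-- All powers of `ad x` fix `y`, whereas in a nilpotent Lie algebra `ad x` is a nilpotent operator.
-/
theorem not_isNilpotent_of_lie_eq_self {x y : L} (hxy : ⁅x, y⁆ = y) (hy : y ≠ 0) :
    ¬ LieRing.IsNilpotent L := by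
  intro h
  obtain ⟨k, hk⟩ := LieModule.isNilpotent_toEnd_of_isNilpotent ℂ L L x
  apply hy
  have hpow : ∀ n : ℕ, (LieModule.toEnd ℂ L L x ^ n) y = y := by
    intro n
    induction n with
    | zero => simp
    | succ n ih => rw [pow_succ', Module.End.mul_apply, ih, LieModule.toEnd_apply_apply, hxy]
  rw [← hpow k, hk, LinearMap.zero_apply]

omit [LieAlgebra ℂ L] in
theorem not_isLieAbelian_of_not_isNilpotent (h : ¬ LieRing.IsNilpotent L) : ¬ IsLieAbelian L :=
  fun _ => h inferInstance

theorem IsHeisenberg.lie_lie_eq_zero (h : IsHeisenberg L) (x y z : L) : ⁅x, ⁅y, z⁆⁆ = 0 := by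
  obtain ⟨b, h01, h02, h12⟩ := h
  simp only [zero_smul, one_smul, zero_add] at h01 h02
  have h10 : ⁅b 1, b 0⁆ = -b 2 := by rw [← lie_skew, h01]
  have h20 : ⁅b 2, b 0⁆ = 0 := by rw [← lie_skew, h02, neg_zero]
  have h21 : ⁅b 2, b 1⁆ = 0 := by rw [← lie_skew, h12, neg_zero]
  obtain ⟨x₀, x₁, x₂, rfl⟩ := basis_expand b x
  obtain ⟨y₀, y₁, y₂, rfl⟩ := basis_expand b y
  obtain ⟨z₀, z₁, z₂, rfl⟩ := basis_expand b z
  simp [h01, h02, h12, h10, h20, h21]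

theorem IsHeisenberg.isNilpotent (h : IsHeisenberg L) : LieRing.IsNilpotent L :=
  isNilpotent_of_triple_lie_eq_zero h.lie_lie_eq_zero

theorem IsHeisenberg.not_isLieAbelian (h : IsHeisenberg L) : ¬ IsLieAbelian L := by
  obtain ⟨b, h01, -, -⟩ := h
  intro hL
  rw [hL.trivial] at h01
  exact b.ne_zero 2 (by simpa using h01.symm)

/-- All brackets lie in the span of `b 1` and `b 2`, which is abelian. -/
theorem HasBasisWithBrackets.lie_lie_lie_eq_zero {x₂ x₃ y₂ y₃ : ℂ}
    (h : HasBasisWithBrackets L x₂ x₃ y₂ y₃) (x y z w : L) : ⁅⁅x, y⁆, ⁅z, w⁆⁆ = 0 := by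
  obtain ⟨b, h01, h02, h12⟩ := h
  have h10 : ⁅b 1, b 0⁆ = -(x₂ • b 1 + x₃ • b 2) := by rw [← lie_skew, h01]
  have h20 : ⁅b 2, b 0⁆ = -(y₂ • b 1 + y₃ • b 2) := by rw [← lie_skew, h02]
  have h21 : ⁅b 2, b 1⁆ = 0 := by rw [← lie_skew, h12, neg_zero]
  have key : ∀ x y : L, ∃ s t : ℂ, ⁅x, y⁆ = s • b 1 + t • b 2 := by
    intro x y
    obtain ⟨x₀, p, q, rfl⟩ := basis_expand b x
    obtain ⟨y₀, r, s, rfl⟩ := basis_expand b y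
    refine ⟨x₀ * (r * x₂ + s * y₂) - y₀ * (p * x₂ + q * y₂),
      x₀ * (r * x₃ + s * y₃) - y₀ * (p * x₃ + q * y₃), ?_⟩
    simp only [add_lie, lie_add, smul_lie, lie_smul, lie_self, h01, h02, h12, h10, h20, h21]
    module
  obtain ⟨s, t, hst⟩ := key x y
  obtain ⟨u, v, huv⟩ := key z w
  simp [hst, huv, h12, h21]

theorem HasBasisWithBrackets.isSolvable {x₂ x₃ y₂ y₃ : ℂ}
    (h : HasBasisWithBrackets L x₂ x₃ y₂ y₃) : LieAlgebra.IsSolvable L :=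
  isSolvable_of_lie_lie_lie_eq_zero h.lie_lie_lie_eq_zero

theorem HasBasisWithBrackets.not_isNilpotent {y₂ y₃ : ℂ}
    (h : HasBasisWithBrackets L 1 0 y₂ y₃) : ¬ LieRing.IsNilpotent L := by
  obtain ⟨b, h01, -, -⟩ := h
  exact not_isNilpotent_of_lie_eq_self (by simpa using h01) (b.ne_zero 1)

theorem HasBasisWithBrackets.not_isNilpotent' {x₂ x₃ : ℂ}
    (h : HasBasisWithBrackets L x₂ x₃ 0 1) : ¬ LieRing.IsNilpotent L := by
  obtain ⟨b, -, h02, -⟩ := h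
  exact not_isNilpotent_of_lie_eq_self (by simpa using h02) (b.ne_zero 2)

theorem not_isSolvable_of_isSimple (h : LieAlgebra.IsSimple ℂ L) : ¬ LieAlgebra.IsSolvable L := by
  intro hs
  have h1 : LieAlgebra.radical ℂ L = ⊤ := LieAlgebra.radical_eq_top_of_isSolvable ℂ L
  have : Nontrivial L := LieAlgebra.IsSimple.nontrivial ℂ L
  rw [LieAlgebra.HasTrivialRadical.radical_eq_bot] at h1
  obtain ⟨x, hx⟩ := exists_ne (0 : L)
  have : x ∈ (⊥ : LieIdeal ℂ L) := h1 ▸ LieSubmodule.mem_top x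
  exact hx (by simpa using this)

theorem HasSl2Basis.isSimple (h : HasSl2Basis L) : LieAlgebra.IsSimple ℂ L := by
  obtain ⟨b, h01, h02, h12⟩ := h
  have h10 : ⁅b 1, b 0⁆ = -((2 : ℂ) • b 1) := by rw [← lie_skew, h01]
  have h20 : ⁅b 2, b 0⁆ = -((-2 : ℂ) • b 2) := by rw [← lie_skew, h02]
  have h21 : ⁅b 2, b 1⁆ = -b 0 := by rw [← lie_skew, h12]
  refine ⟨fun I => ?_, fun hL => ?_⟩
  · rw [or_iff_not_imp_left]
    intro hI
    have hmem : ∀ {c : ℂ} {x : L}, c ≠ 0 → c • x ∈ I → x ∈ I := by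
      intro c x hc hx
      rw [← inv_smul_smul₀ hc x]
      exact I.smul_mem _ hx
    have hlie : ∀ {x : L} (y : L), x ∈ I → ⁅y, x⁆ ∈ I := fun y hx => lie_mem_right ℂ L I y _ hx
    have key : b 1 ∈ I → I = ⊤ := by
      intro h1
      have h0 : b 0 ∈ I := by
        have := hlie (b 2) h1
        rw [h21] at this
        exact neg_mem_iff.1 this
      have h2 : b 2 ∈ I := by
        have := hlie (b 2) h0
        rw [h20, ← neg_smul] at this
        exact hmem (by norm_num) this
      rw [eq_top_iff]
      intro x _
      obtain ⟨a, c, d, rfl⟩ := basis_expand b x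
      exact add_mem (add_mem (I.smul_mem _ h0) (I.smul_mem _ h1)) (I.smul_mem _ h2)
    obtain ⟨x, hx, hx0⟩ : ∃ x ∈ I, x ≠ 0 := by
      by_contra! hcon
      exact hI ((LieSubmodule.eq_bot_iff _).2 hcon)
    obtain ⟨a, c, d, rfl⟩ := basis_expand b x
    have hx1 := hlie (b 1) hx
    -- Raising by `e` at most twice brings any nonzero element of the ideal to a nonzero multiple of
    -- `e`, and `e` generates everything.
    have e1 : ⁅b 1, a • b 0 + c • b 1 + d • b 2⁆ = (-2 * a) • b 1 + d • b 0 := by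
      simp only [lie_add, lie_smul, lie_self, h10, h12]
      module
    rw [e1] at hx1
    by_cases hd : d = 0
    · by_cases ha : a = 0
      · subst hd ha
        have hc : c ≠ 0 := by
          rintro rfl
          simp at hx0
        exact key (hmem hc (by simpa using hx))
      · subst hd
        exact key (hmem (c := -2 * a) (by simpa using ha) (by simpa using hx1))
    · have hx2 := hlie (b 1) hx1
      have e2 : ⁅b 1, (-2 * a) • b 1 + d • b 0⁆ = (-2 * d) • b 1 := by
        simp only [lie_add, lie_smul, lie_self, h10]
        module
      rw [e2] at hx2
      exact key (hmem (c := -2 * d) (by simpa using hd) hx2)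
  · rw [hL.trivial] at h12
    exact b.ne_zero 0 h12.symm

theorem HasSl2Basis.nonempty_lieEquiv {L' : Type*} [LieRing L'] [LieAlgebra ℂ L']
    (h : HasSl2Basis L) (h' : HasSl2Basis L') : Nonempty (L ≃ₗ⁅ℂ⁆ L') := by
  obtain ⟨b, h01, h02, h12⟩ := h
  obtain ⟨c, k01, k02, k12⟩ := h'
  have h10 : ⁅b 1, b 0⁆ = -((2 : ℂ) • b 1) := by rw [← lie_skew, h01]
  have h20 : ⁅b 2, b 0⁆ = -((-2 : ℂ) • b 2) := by rw [← lie_skew, h02]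
  have h21 : ⁅b 2, b 1⁆ = -b 0 := by rw [← lie_skew, h12]
  have k10 : ⁅c 1, c 0⁆ = -((2 : ℂ) • c 1) := by rw [← lie_skew, k01]
  have k20 : ⁅c 2, c 0⁆ = -((-2 : ℂ) • c 2) := by rw [← lie_skew, k02]
  have k21 : ⁅c 2, c 1⁆ = -c 0 := by rw [← lie_skew, k12]
  let e : L ≃ₗ[ℂ] L' := b.equiv c (Equiv.refl _)
  have he : ∀ i, e (b i) = c i := fun i => by simp [e]
  refine ⟨{ e with map_lie' := ?_ }⟩
  intro x y
  change e ⁅x, y⁆ = ⁅e x, e y⁆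
  obtain ⟨x₀, x₁, x₂, rfl⟩ := basis_expand b x
  obtain ⟨y₀, y₁, y₂, rfl⟩ := basis_expand b y
  simp only [lie_add, add_lie, lie_smul, smul_lie, lie_self, map_add, map_smul, he, h01, h02, h12,
    h10, h20, h21, k01, k02, k12, k10, k20, k21, map_neg, map_zero]

theorem HasSl2Basis.of_lieEquiv {L' : Type*} [LieRing L'] [LieAlgebra ℂ L']
    (h : HasSl2Basis L) (e : L ≃ₗ⁅ℂ⁆ L') : HasSl2Basis L' := by
  obtain ⟨b, h01, h02, h12⟩ := h
  refine ⟨b.map e.toLinearEquiv, ?_, ?_, ?_⟩ <;>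
    simp [← LieEquiv.map_lie, h01, h02, h12]

theorem hasSl2Basis_sl : HasSl2Basis (LieAlgebra.SpecialLinear.sl (Fin 2) ℂ) := by
  -- A traceless matrix is determined by three entries; the corresponding basis is the standard `h,
  -- e, f`.
  let φ : LieAlgebra.SpecialLinear.sl (Fin 2) ℂ ≃ₗ[ℂ] (Fin 3 → ℂ) :=
    { toFun := fun A => ![A.1 0 0, A.1 0 1, A.1 1 0]
      map_add' := fun A B => by ext i; fin_cases i <;> simp
      map_smul' := fun t A => by ext i; fin_cases i <;> simp
      invFun := fun v => ⟨!![v 0, v 1; v 2, -v 0], by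
        change Matrix.trace !![v 0, v 1; v 2, -v 0] = 0
        simp [Matrix.trace_fin_two]⟩
      left_inv := fun A => by
        have hA : A.1 0 0 + A.1 1 1 = 0 := by
          rw [← Matrix.trace_fin_two]; exact A.2
        ext i j
        fin_cases i <;> fin_cases j <;> simp
        linear_combination -hA
      right_inv := fun v => by ext i; fin_cases i <;> simp }
  have h0 : (Module.Basis.ofEquivFun φ) 0 = φ.symm ![1, 0, 0] := by
    rw [Module.Basis.coe_ofEquivFun]; congr 1
  have h1 : (Module.Basis.ofEquivFun φ) 1 = φ.symm ![0, 1, 0] := by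
    rw [Module.Basis.coe_ofEquivFun]; congr 1
  have h2 : (Module.Basis.ofEquivFun φ) 2 = φ.symm ![0, 0, 1] := by
    rw [Module.Basis.coe_ofEquivFun]; congr 1
  have hφ : ∀ v, (φ.symm v).1 = !![v 0, v 1; v 2, -v 0] := fun v => rfl
  refine ⟨Module.Basis.ofEquivFun φ, ?_, ?_, ?_⟩ <;> rw [Subtype.ext_iff] <;>
    simp only [h0, h1, h2, LieAlgebra.SpecialLinear.sl_bracket, hφ] <;>
    ext i j <;> fin_cases i <;> fin_cases j <;> simp [hφ] <;> norm_num

theorem nonempty_lieEquiv_sl_iff :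
    Nonempty (L ≃ₗ⁅ℂ⁆ LieAlgebra.SpecialLinear.sl (Fin 2) ℂ) ↔ HasSl2Basis L :=
  ⟨fun ⟨e⟩ => hasSl2Basis_sl.of_lieEquiv e.symm, fun h => h.nonempty_lieEquiv hasSl2Basis_sl⟩

theorem HasSl2Basis.not_isSolvable (h : HasSl2Basis L) : ¬ LieAlgebra.IsSolvable L :=
  not_isSolvable_of_isSimple h.isSimple

/-- Among the types of `lie_classification` only the Heisenberg one survives: the solvable ones
contain a relation `⁅x, y⁆ = y ≠ 0`, and `sl(2)` is not solvable. -/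
theorem isNilpotent_and_not_isLieAbelian_iff (hV : Module.finrank ℂ L = 3) :
    (LieRing.IsNilpotent L ∧ ¬ IsLieAbelian L) ↔ IsHeisenberg L := by
  refine ⟨fun ⟨hn, ha⟩ => ?_, fun h => ⟨h.isNilpotent, h.not_isLieAbelian⟩⟩
  rcases lie_classification hV ha with (h | h | ⟨α, -, h⟩ | h) | h
  · exact h
  · exact absurd hn h.not_isNilpotent
  · exact absurd hn h.not_isNilpotent
  · exact absurd hn h.not_isNilpotent'
  · exact absurd (LieAlgebra.isSolvable_of_isNilpotent L) h.not_isSolvable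

theorem isSolvable_and_not_isNilpotent_iff (hV : Module.finrank ℂ L = 3) :
    (LieAlgebra.IsSolvable L ∧ ¬ LieRing.IsNilpotent L) ↔
      HasBasisWithBrackets L 1 0 0 0 ∨
      (∃ α : ℂ, α ≠ 0 ∧ HasBasisWithBrackets L 1 0 0 α) ∨
      HasBasisWithBrackets L 1 1 0 1 := by
  refine ⟨fun ⟨hs, hn⟩ => ?_, ?_⟩
  · rcases lie_classification hV (not_isLieAbelian_of_not_isNilpotent hn) with (h | h) | h
    · exact absurd h.isNilpotent hn
    · exact h
    · exact absurd hs h.not_isSolvable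
  · rintro (h | ⟨α, -, h⟩ | h)
    · exact ⟨h.isSolvable, h.not_isNilpotent⟩
    · exact ⟨h.isSolvable, h.not_isNilpotent⟩
    · exact ⟨h.isSolvable, h.not_isNilpotent'⟩

theorem isSimple_iff_hasSl2Basis (hV : Module.finrank ℂ L = 3) :
    LieAlgebra.IsSimple ℂ L ↔ HasSl2Basis L := by
  refine ⟨fun hs => ?_, HasSl2Basis.isSimple⟩
  have hn := not_isSolvable_of_isSimple hs
  rcases lie_classification hV hs.non_abelian with (h | h | ⟨α, -, h⟩ | h) | h
  · exact absurd h.isSolvable hn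
  · exact absurd h.isSolvable hn
  · exact absurd h.isSolvable hn
  · exact absurd h.isSolvable hn
  · exact h

end LieTypes

namespace PoissonStructure

/-! ### Coordinate formulas for the two operations in each table. -/

section Tables

variable (X Y : Fin 3 → ℂ) (γ : ℂ)

theorem P31_bracket : (P31 γ).bracket X Y = ![0, 0, X 0 * Y 1 - X 1 * Y 0] := by
  ext k; fin_cases k <;>
    simp [P31, ofTable, skewPart, productOfTable, Fin.sum_univ_three, e₁, e₂, e₃] <;> ring

theorem P31_mul : (P31 γ).mul X Y = ![0, 0, γ * (X 0 * Y 1 + X 1 * Y 0)] := by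
  ext k; fin_cases k <;>
    simp [P31, ofTable, symmPart, productOfTable, Fin.sum_univ_three, e₁, e₂, e₃] <;> ring

theorem P32_bracket : P32.bracket X Y = ![0, 0, X 0 * Y 1 - X 1 * Y 0] := by
  ext k; fin_cases k <;>
    simp [P32, ofTable, skewPart, productOfTable, Fin.sum_univ_three, e₁, e₂, e₃] <;> ring

theorem P32_mul : P32.mul X Y = ![0, 0, X 0 * Y 0] := by
  ext k; fin_cases k <;>
    simp [P32, ofTable, symmPart, productOfTable, Fin.sum_univ_three, e₁, e₂, e₃] <;> ring

theorem P33_bracket : (P33 γ).bracket X Y = ![0, X 0 * Y 1 - X 1 * Y 0, 0] := by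
  ext k; fin_cases k <;>
    simp [P33, ofTable, skewPart, productOfTable, Fin.sum_univ_three, e₁, e₂, e₃] <;> ring

theorem P33_mul : (P33 γ).mul X Y =
    ![0, 0, γ ^ 2 * (X 0 * Y 0) + γ * (X 0 * Y 2 + X 2 * Y 0) + X 2 * Y 2] := by
  ext k; fin_cases k <;>
    simp [P33, ofTable, symmPart, productOfTable, Fin.sum_univ_three, e₁, e₂, e₃] <;> ring

theorem P34_bracket : P34.bracket X Y = ![0, X 0 * Y 1 - X 1 * Y 0, 0] := by
  ext k; fin_cases k <;>
    simp [P34, ofTable, skewPart, productOfTable, Fin.sum_univ_three, e₁, e₂, e₃] <;> ring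

theorem P34_mul : P34.mul X Y = ![0, 0, X 0 * Y 0] := by
  ext k; fin_cases k <;>
    simp [P34, ofTable, symmPart, productOfTable, Fin.sum_univ_three, e₁, e₂, e₃] <;> ring

theorem P35_bracket : P35.bracket X Y = ![0, X 0 * Y 1 - X 1 * Y 0, 0] := by
  ext k; fin_cases k <;>
    simp [P35, ofTable, skewPart, productOfTable, Fin.sum_univ_three, e₁, e₂, e₃] <;> ring

theorem P35_mul : P35.mul X Y = 0 := by
  ext k; fin_cases k <;>
    simp [P35, ofTable, symmPart, productOfTable, Fin.sum_univ_three, e₁, e₂, e₃] <;> ring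

theorem P36_bracket : P36.bracket X Y = ![0, X 0 * Y 1 - X 1 * Y 0, 0] := by
  ext k; fin_cases k <;>
    simp [P36, ofTable, skewPart, productOfTable, Fin.sum_univ_three, e₁, e₂, e₃] <;> ring

theorem P36_mul : P36.mul X Y =
    ![X 0 * Y 2 + X 2 * Y 0, X 1 * Y 2 + X 2 * Y 1, X 2 * Y 2] := by
  ext k; fin_cases k <;>
    simp [P36, ofTable, symmPart, productOfTable, Fin.sum_univ_three, e₁, e₂, e₃] <;> ring

theorem P37_bracket : (P37 γ).bracket X Y =
    ![0, X 0 * Y 1 - X 1 * Y 0, γ * (X 0 * Y 2 - X 2 * Y 0)] := by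
  ext k; fin_cases k <;>
    simp [P37, ofTable, skewPart, productOfTable, Fin.sum_univ_three, e₁, e₂, e₃] <;> ring

theorem P37_mul : (P37 γ).mul X Y = 0 := by
  ext k; fin_cases k <;>
    simp [P37, ofTable, symmPart, productOfTable, Fin.sum_univ_three, e₁, e₂, e₃] <;> ring

theorem P38_bracket : P38.bracket X Y = ![0, X 0 * Y 1 - X 1 * Y 0,
    (X 0 * Y 1 - X 1 * Y 0) + (X 0 * Y 2 - X 2 * Y 0)] := by
  ext k; fin_cases k <;>
    simp [P38, ofTable, skewPart, productOfTable, Fin.sum_univ_three, e₁, e₂, e₃] <;> ring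

theorem P38_mul : P38.mul X Y = 0 := by
  ext k; fin_cases k <;>
    simp [P38, ofTable, symmPart, productOfTable, Fin.sum_univ_three, e₁, e₂, e₃] <;> ring

theorem P39_bracket : P39.bracket X Y = ![X 1 * Y 2 - X 2 * Y 1, 2 * (X 0 * Y 1 - X 1 * Y 0),
    -2 * (X 0 * Y 2 - X 2 * Y 0)] := by
  ext k; fin_cases k <;>
    simp [P39, ofTable, skewPart, productOfTable, Fin.sum_univ_three, e₁, e₂, e₃] <;> ring

theorem P39_mul : P39.mul X Y = 0 := by
  ext k; fin_cases k <;>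
    simp [P39, ofTable, symmPart, productOfTable, Fin.sum_univ_three, e₁, e₂, e₃] <;> ring

end Tables

/-! ### Isomorphism with a table as existence of an adapted basis. -/

section Basis

variable {V : Type*} [AddCommGroup V] [Module ℂ V] (P : PoissonStructure ℂ V)

/-- An isomorphism onto `ℂ³` is the coordinate map of a basis. Skew-symmetry and commutativity
reduce the conditions to three brackets and six products. -/
theorem isIsomorphic_iff_exists_basis (Q : PoissonStructure ℂ (Fin 3 → ℂ)) :
    P.IsIsomorphic Q ↔ ∃ b : Module.Basis (Fin 3) ℂ V,
      (P.bracket (b 0) (b 1) = b.equivFun.symm (Q.bracket ![1, 0, 0] ![0, 1, 0]) ∧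
        P.bracket (b 0) (b 2) = b.equivFun.symm (Q.bracket ![1, 0, 0] ![0, 0, 1]) ∧
        P.bracket (b 1) (b 2) = b.equivFun.symm (Q.bracket ![0, 1, 0] ![0, 0, 1])) ∧
      P.mul (b 0) (b 0) = b.equivFun.symm (Q.mul ![1, 0, 0] ![1, 0, 0]) ∧
        P.mul (b 0) (b 1) = b.equivFun.symm (Q.mul ![1, 0, 0] ![0, 1, 0]) ∧
        P.mul (b 0) (b 2) = b.equivFun.symm (Q.mul ![1, 0, 0] ![0, 0, 1]) ∧
        P.mul (b 1) (b 1) = b.equivFun.symm (Q.mul ![0, 1, 0] ![0, 1, 0]) ∧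
        P.mul (b 1) (b 2) = b.equivFun.symm (Q.mul ![0, 1, 0] ![0, 0, 1]) ∧
        P.mul (b 2) (b 2) = b.equivFun.symm (Q.mul ![0, 0, 1] ![0, 0, 1]) := by
  have hbasis : ∀ b : Module.Basis (Fin 3) ℂ V, b.equivFun (b 0) = ![1, 0, 0] ∧
      b.equivFun (b 1) = ![0, 1, 0] ∧ b.equivFun (b 2) = ![0, 0, 1] := by
    intro b
    refine ⟨?_, ?_, ?_⟩ <;> ext i <;> fin_cases i <;> simp [Module.Basis.equivFun_self]
  constructor
  · rintro ⟨e, hbr, hmul⟩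
    refine ⟨Module.Basis.ofEquivFun e, ?_⟩
    have h := hbasis (Module.Basis.ofEquivFun e)
    rw [Module.Basis.equivFun_ofEquivFun] at h ⊢
    obtain ⟨h0, h1, h2⟩ := h
    simp only [LinearEquiv.eq_symm_apply, hbr, hmul, h0, h1, h2, and_self]
  · rintro ⟨b, ⟨h01, h02, h12⟩, m00, m01, m02, m11, m12, m22⟩
    obtain ⟨e0, e1, e2⟩ := hbasis b
    rw [LinearEquiv.eq_symm_apply] at h01 h02 h12 m00 m01 m02 m11 m12 m22
    refine ⟨b.equivFun, fun X Y => ?_, fun X Y => ?_⟩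
    · obtain ⟨x₀, x₁, x₂, rfl⟩ := basis_expand b X
      obtain ⟨y₀, y₁, y₂, rfl⟩ := basis_expand b Y
      simp only [map_add, map_smul, LinearMap.add_apply, LinearMap.smul_apply, P.bracket_self,
        P.bracket_skew (b 1) (b 0), P.bracket_skew (b 2) (b 0), P.bracket_skew (b 2) (b 1),
        map_neg, h01, h02, h12, e0, e1, e2, Q.bracket_self, map_zero,
        Q.bracket_skew ![0, 1, 0] ![1, 0, 0], Q.bracket_skew ![0, 0, 1] ![1, 0, 0],
        Q.bracket_skew ![0, 0, 1] ![0, 1, 0]]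
    · obtain ⟨x₀, x₁, x₂, rfl⟩ := basis_expand b X
      obtain ⟨y₀, y₁, y₂, rfl⟩ := basis_expand b Y
      simp only [map_add, map_smul, LinearMap.add_apply, LinearMap.smul_apply,
        P.mul_comm (b 1) (b 0), P.mul_comm (b 2) (b 0), P.mul_comm (b 2) (b 1),
        m00, m01, m02, m11, m12, m22, e0, e1, e2,
        Q.mul_comm ![0, 1, 0] ![1, 0, 0], Q.mul_comm ![0, 0, 1] ![1, 0, 0],
        Q.mul_comm ![0, 0, 1] ![0, 1, 0]]

theorem isIsomorphic_P31_iff (γ : ℂ) : P.IsIsomorphic (P31 γ) ↔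
    ∃ b : Module.Basis (Fin 3) ℂ V,
      (P.bracket (b 0) (b 1) = b 2 ∧ P.bracket (b 0) (b 2) = 0 ∧ P.bracket (b 1) (b 2) = 0) ∧
      P.mul (b 0) (b 0) = 0 ∧ P.mul (b 0) (b 1) = γ • b 2 ∧ P.mul (b 0) (b 2) = 0 ∧
      P.mul (b 1) (b 1) = 0 ∧ P.mul (b 1) (b 2) = 0 ∧ P.mul (b 2) (b 2) = 0 := by
  simp [isIsomorphic_iff_exists_basis, P31_bracket, P31_mul, Module.Basis.equivFun_symm_apply,
    Fin.sum_univ_three]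

theorem isIsomorphic_P32_iff : P.IsIsomorphic P32 ↔
    ∃ b : Module.Basis (Fin 3) ℂ V,
      (P.bracket (b 0) (b 1) = b 2 ∧ P.bracket (b 0) (b 2) = 0 ∧ P.bracket (b 1) (b 2) = 0) ∧
      P.mul (b 0) (b 0) = b 2 ∧ P.mul (b 0) (b 1) = 0 ∧ P.mul (b 0) (b 2) = 0 ∧
      P.mul (b 1) (b 1) = 0 ∧ P.mul (b 1) (b 2) = 0 ∧ P.mul (b 2) (b 2) = 0 := by
  simp [isIsomorphic_iff_exists_basis, P32_bracket, P32_mul, Module.Basis.equivFun_symm_apply,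
    Fin.sum_univ_three]

theorem isIsomorphic_P33_iff (α : ℂ) : P.IsIsomorphic (P33 α) ↔
    ∃ b : Module.Basis (Fin 3) ℂ V,
      (P.bracket (b 0) (b 1) = b 1 ∧ P.bracket (b 0) (b 2) = 0 ∧ P.bracket (b 1) (b 2) = 0) ∧
      P.mul (b 0) (b 0) = α ^ 2 • b 2 ∧ P.mul (b 0) (b 1) = 0 ∧ P.mul (b 0) (b 2) = α • b 2 ∧
      P.mul (b 1) (b 1) = 0 ∧ P.mul (b 1) (b 2) = 0 ∧ P.mul (b 2) (b 2) = b 2 := by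
  simp [isIsomorphic_iff_exists_basis, P33_bracket, P33_mul, Module.Basis.equivFun_symm_apply,
    Fin.sum_univ_three]

theorem isIsomorphic_P34_iff : P.IsIsomorphic P34 ↔
    ∃ b : Module.Basis (Fin 3) ℂ V,
      (P.bracket (b 0) (b 1) = b 1 ∧ P.bracket (b 0) (b 2) = 0 ∧ P.bracket (b 1) (b 2) = 0) ∧
      P.mul (b 0) (b 0) = b 2 ∧ P.mul (b 0) (b 1) = 0 ∧ P.mul (b 0) (b 2) = 0 ∧
      P.mul (b 1) (b 1) = 0 ∧ P.mul (b 1) (b 2) = 0 ∧ P.mul (b 2) (b 2) = 0 := by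
  simp [isIsomorphic_iff_exists_basis, P34_bracket, P34_mul, Module.Basis.equivFun_symm_apply,
    Fin.sum_univ_three]

theorem isIsomorphic_P35_iff : P.IsIsomorphic P35 ↔
    ∃ b : Module.Basis (Fin 3) ℂ V,
      (P.bracket (b 0) (b 1) = b 1 ∧ P.bracket (b 0) (b 2) = 0 ∧ P.bracket (b 1) (b 2) = 0) ∧
      P.mul (b 0) (b 0) = 0 ∧ P.mul (b 0) (b 1) = 0 ∧ P.mul (b 0) (b 2) = 0 ∧
      P.mul (b 1) (b 1) = 0 ∧ P.mul (b 1) (b 2) = 0 ∧ P.mul (b 2) (b 2) = 0 := by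
  simp [isIsomorphic_iff_exists_basis, P35_bracket, P35_mul, Module.Basis.equivFun_symm_apply,
    Fin.sum_univ_three]

theorem isIsomorphic_P36_iff : P.IsIsomorphic P36 ↔
    ∃ b : Module.Basis (Fin 3) ℂ V,
      (P.bracket (b 0) (b 1) = b 1 ∧ P.bracket (b 0) (b 2) = 0 ∧ P.bracket (b 1) (b 2) = 0) ∧
      P.mul (b 0) (b 0) = 0 ∧ P.mul (b 0) (b 1) = 0 ∧ P.mul (b 0) (b 2) = b 0 ∧
      P.mul (b 1) (b 1) = 0 ∧ P.mul (b 1) (b 2) = b 1 ∧ P.mul (b 2) (b 2) = b 2 := by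
  simp [isIsomorphic_iff_exists_basis, P36_bracket, P36_mul, Module.Basis.equivFun_symm_apply,
    Fin.sum_univ_three]

theorem isIsomorphic_P37_iff (α : ℂ) : P.IsIsomorphic (P37 α) ↔
    ∃ b : Module.Basis (Fin 3) ℂ V,
      (P.bracket (b 0) (b 1) = b 1 ∧ P.bracket (b 0) (b 2) = α • b 2 ∧
        P.bracket (b 1) (b 2) = 0) ∧
      P.mul (b 0) (b 0) = 0 ∧ P.mul (b 0) (b 1) = 0 ∧ P.mul (b 0) (b 2) = 0 ∧
      P.mul (b 1) (b 1) = 0 ∧ P.mul (b 1) (b 2) = 0 ∧ P.mul (b 2) (b 2) = 0 := by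
  simp [isIsomorphic_iff_exists_basis, P37_bracket, P37_mul, Module.Basis.equivFun_symm_apply,
    Fin.sum_univ_three]

theorem isIsomorphic_P38_iff : P.IsIsomorphic P38 ↔
    ∃ b : Module.Basis (Fin 3) ℂ V,
      (P.bracket (b 0) (b 1) = b 1 + b 2 ∧ P.bracket (b 0) (b 2) = b 2 ∧
        P.bracket (b 1) (b 2) = 0) ∧
      P.mul (b 0) (b 0) = 0 ∧ P.mul (b 0) (b 1) = 0 ∧ P.mul (b 0) (b 2) = 0 ∧
      P.mul (b 1) (b 1) = 0 ∧ P.mul (b 1) (b 2) = 0 ∧ P.mul (b 2) (b 2) = 0 := by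
  simp [isIsomorphic_iff_exists_basis, P38_bracket, P38_mul, Module.Basis.equivFun_symm_apply,
    Fin.sum_univ_three]

theorem isIsomorphic_P39_iff : P.IsIsomorphic P39 ↔
    ∃ b : Module.Basis (Fin 3) ℂ V,
      (P.bracket (b 0) (b 1) = (2 : ℂ) • b 1 ∧ P.bracket (b 0) (b 2) = (-2 : ℂ) • b 2 ∧
        P.bracket (b 1) (b 2) = b 0) ∧
      P.mul (b 0) (b 0) = 0 ∧ P.mul (b 0) (b 1) = 0 ∧ P.mul (b 0) (b 2) = 0 ∧
      P.mul (b 1) (b 1) = 0 ∧ P.mul (b 1) (b 2) = 0 ∧ P.mul (b 2) (b 2) = 0 := by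
  simp [isIsomorphic_iff_exists_basis, P39_bracket, P39_mul, Module.Basis.equivFun_symm_apply,
    Fin.sum_univ_three]

theorem hasBasisWithBrackets_iff (x₂ x₃ y₂ y₃ : ℂ) :
    HasBasisWithBrackets P.LiePart x₂ x₃ y₂ y₃ ↔ ∃ b : Module.Basis (Fin 3) ℂ V,
      P.bracket (b 0) (b 1) = x₂ • b 1 + x₃ • b 2 ∧
        P.bracket (b 0) (b 2) = y₂ • b 1 + y₃ • b 2 ∧ P.bracket (b 1) (b 2) = 0 :=
  Iff.rfl

theorem hasSl2Basis_iff :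
    HasSl2Basis P.LiePart ↔ ∃ b : Module.Basis (Fin 3) ℂ V,
      P.bracket (b 0) (b 1) = (2 : ℂ) • b 1 ∧ P.bracket (b 0) (b 2) = (-2 : ℂ) • b 2 ∧
        P.bracket (b 1) (b 2) = b 0 :=
  Iff.rfl

/-- The Leibniz identity in structure constants; once the brackets are known it is a linear system
for the product. -/
theorem leibniz_repr (b : Module.Basis (Fin 3) ℂ V) (i j k l : Fin 3) :
    ∑ m, b.repr (P.mul (b i) (b j)) m * b.repr (P.bracket (b m) (b k)) l =
      ∑ m, b.repr (P.bracket (b j) (b k)) m * b.repr (P.mul (b i) (b m)) l +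
        ∑ m, b.repr (P.bracket (b i) (b k)) m * b.repr (P.mul (b m) (b j)) l := by
  have h := congrArg (fun v => b.repr v l) (P.leibniz (b i) (b j) (b k))
  rw [← b.sum_repr (P.mul (b i) (b j)), ← b.sum_repr (P.bracket (b j) (b k)),
    ← b.sum_repr (P.bracket (b i) (b k))] at h
  simpa [-Module.Basis.sum_repr, Finsupp.finsetSum_apply] using h

theorem assoc_repr (b : Module.Basis (Fin 3) ℂ V) (i j k l : Fin 3) :
    ∑ m, b.repr (P.mul (b i) (b j)) m * b.repr (P.mul (b m) (b k)) l =
      ∑ m, b.repr (P.mul (b j) (b k)) m * b.repr (P.mul (b i) (b m)) l := by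
  have h := congrArg (fun v => b.repr v l) (P.mul_assoc (b i) (b j) (b k))
  rw [← b.sum_repr (P.mul (b i) (b j)), ← b.sum_repr (P.mul (b j) (b k))] at h
  simpa [-Module.Basis.sum_repr, Finsupp.finsetSum_apply] using h

end Basis

end PoissonStructure

namespace PoissonStructure

theorem forall_fin_three_iff {p : Fin 3 → Prop} : (∀ i, p i) ↔ p 0 ∧ p 1 ∧ p 2 :=
  ⟨fun h => ⟨h 0, h 1, h 2⟩, fun ⟨h0, h1, h2⟩ i => by fin_cases i <;> assumption⟩

/-! ### Products compatible with a given bracket. -/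

section Products

variable {V : Type*} [AddCommGroup V] [Module ℂ V] (P : PoissonStructure ℂ V)

theorem eq_comb_of_repr (b : Module.Basis (Fin 3) ℂ V) {v : V} {x y z : ℂ} (h0 : b.repr v 0 = x)
    (h1 : b.repr v 1 = y) (h2 : b.repr v 2 = z) : v = x • b 0 + y • b 1 + z • b 2 := by
  rw [← h0, ← h1, ← h2, ← Fin.sum_univ_three (fun i => b.repr v i • b i), b.sum_repr]

theorem eq_zero_of_repr (b : Module.Basis (Fin 3) ℂ V) {v : V} (h0 : b.repr v 0 = 0)
    (h1 : b.repr v 1 = 0) (h2 : b.repr v 2 = 0) : v = 0 := by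
  rw [eq_comb_of_repr b h0 h1 h2]
  simp

/-- The derivations `{ · , b 1}` and `{ · , b 2}` kill `b 1` and `b 2`. Together with `{ · , b 0}`
they force `b 0 • b 0 = x b 0`, make `b 0` multiply `b 1` and `b 2` by `x / 2`, and annihilate all
other products. -/
theorem mul_eq_zero_of_solvable (b : Module.Basis (Fin 3) ℂ V) {α β : ℂ} (hα : α ≠ 0)
    (h01 : P.bracket (b 0) (b 1) = b 1 + β • b 2) (h02 : P.bracket (b 0) (b 2) = α • b 2)
    (h12 : P.bracket (b 1) (b 2) = 0) :
    P.mul (b 0) (b 0) = 0 ∧ P.mul (b 0) (b 1) = 0 ∧ P.mul (b 0) (b 2) = 0 ∧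
      P.mul (b 1) (b 1) = 0 ∧ P.mul (b 1) (b 2) = 0 ∧ P.mul (b 2) (b 2) = 0 := by
  have h10 : P.bracket (b 1) (b 0) = -(b 1 + β • b 2) := by rw [P.bracket_skew, h01]
  have h20 : P.bracket (b 2) (b 0) = -(α • b 2) := by rw [P.bracket_skew, h02]
  have h21 : P.bracket (b 2) (b 1) = 0 := by rw [P.bracket_skew, h12, neg_zero]
  have H := P.leibniz_repr b
  simp [forall_fin_three_iff, Fin.sum_univ_three, h01, h02, h12, h10, h20, h21, P.bracket_self,
    P.mul_comm (b 1) (b 0), P.mul_comm (b 2) (b 0), P.mul_comm (b 2) (b 1), hα] at H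
  -- Associativity on `b 0, b 0, b 2` gives `x ^ 2 / 2 = x ^ 2 / 4`, so the remaining coefficient
  -- vanishes.
  have A := P.assoc_repr b 0 0 2 2
  simp only [Fin.sum_univ_three] at A
  refine ⟨?_, ?_, ?_, ?_, ?_, ?_⟩ <;> refine eq_zero_of_repr b ?_ ?_ ?_ <;> grind

/-- The product is an equivariant map from the symmetric square of the adjoint representation to the
adjoint one. That square is the sum of the irreducibles of dimensions 5 and 1, so the map is zero;
associativity plays no role. -/
theorem mul_eq_zero_of_sl2 (b : Module.Basis (Fin 3) ℂ V)
    (h01 : P.bracket (b 0) (b 1) = (2 : ℂ) • b 1) (h02 : P.bracket (b 0) (b 2) = (-2 : ℂ) • b 2)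
    (h12 : P.bracket (b 1) (b 2) = b 0) :
    P.mul (b 0) (b 0) = 0 ∧ P.mul (b 0) (b 1) = 0 ∧ P.mul (b 0) (b 2) = 0 ∧
      P.mul (b 1) (b 1) = 0 ∧ P.mul (b 1) (b 2) = 0 ∧ P.mul (b 2) (b 2) = 0 := by
  have h10 : P.bracket (b 1) (b 0) = -((2 : ℂ) • b 1) := by rw [P.bracket_skew, h01]
  have h20 : P.bracket (b 2) (b 0) = -((-2 : ℂ) • b 2) := by rw [P.bracket_skew, h02]
  have h21 : P.bracket (b 2) (b 1) = -b 0 := by rw [P.bracket_skew, h12]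
  have H := P.leibniz_repr b
  simp [forall_fin_three_iff, Fin.sum_univ_three, h01, h02, h12, h10, h20, h21, P.bracket_self,
    P.mul_comm (b 1) (b 0), P.mul_comm (b 2) (b 0), P.mul_comm (b 2) (b 1)] at H
  refine ⟨?_, ?_, ?_, ?_, ?_, ?_⟩ <;> refine eq_zero_of_repr b ?_ ?_ ?_ <;> grind

theorem exists_mul_of_heisenberg (b : Module.Basis (Fin 3) ℂ V)
    (h01 : P.bracket (b 0) (b 1) = b 2) (h02 : P.bracket (b 0) (b 2) = 0)
    (h12 : P.bracket (b 1) (b 2) = 0) :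
    ∃ a g d : ℂ, P.mul (b 0) (b 0) = a • b 2 ∧ P.mul (b 0) (b 1) = g • b 2 ∧
      P.mul (b 0) (b 2) = 0 ∧ P.mul (b 1) (b 1) = d • b 2 ∧ P.mul (b 1) (b 2) = 0 ∧
      P.mul (b 2) (b 2) = 0 := by
  have h10 : P.bracket (b 1) (b 0) = -b 2 := by rw [P.bracket_skew, h01]
  have h20 : P.bracket (b 2) (b 0) = 0 := by rw [P.bracket_skew, h02, neg_zero]
  have h21 : P.bracket (b 2) (b 1) = 0 := by rw [P.bracket_skew, h12, neg_zero]
  have H := P.leibniz_repr b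
  simp [forall_fin_three_iff, Fin.sum_univ_three, h01, h02, h12, h10, h20, h21, P.bracket_self,
    P.mul_comm (b 1) (b 0), P.mul_comm (b 2) (b 0), P.mul_comm (b 2) (b 1)] at H
  have A := P.assoc_repr b 0 0 2 2
  have A' := P.assoc_repr b 1 1 2 2
  simp only [Fin.sum_univ_three, P.mul_comm (b 1) (b 0)] at A A'
  refine ⟨b.repr (P.mul (b 0) (b 0)) 2, b.repr (P.mul (b 0) (b 1)) 2,
    b.repr (P.mul (b 1) (b 1)) 2, ?_, ?_, ?_, ?_, ?_, ?_⟩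
  · refine (eq_comb_of_repr b (x := 0) (y := 0) ?_ ?_ rfl).trans (by simp) <;> grind
  · refine (eq_comb_of_repr b (x := 0) (y := 0) ?_ ?_ rfl).trans (by simp) <;> grind
  · refine eq_zero_of_repr b ?_ ?_ ?_ <;> grind
  · refine (eq_comb_of_repr b (x := 0) (y := 0) ?_ ?_ rfl).trans (by simp) <;> grind
  · refine eq_zero_of_repr b ?_ ?_ ?_ <;> grind
  · refine eq_zero_of_repr b ?_ ?_ ?_ <;> grind

/-- Leibniz reduces the product to the parameters `l, m, n, r, s`. The four relations are
associativity on the triples `(0, 0, 1)`, `(0, 2, 1)`, `(2, 2, 1)` and `(0, 0, 2)`. -/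
theorem exists_mul_of_affine (b : Module.Basis (Fin 3) ℂ V)
    (h01 : P.bracket (b 0) (b 1) = b 1) (h02 : P.bracket (b 0) (b 2) = 0)
    (h12 : P.bracket (b 1) (b 2) = 0) :
    ∃ l m n r s : ℂ, P.mul (b 0) (b 0) = (2 * m) • b 0 + r • b 2 ∧ P.mul (b 0) (b 1) = m • b 1 ∧
      P.mul (b 0) (b 2) = l • b 0 + s • b 2 ∧ P.mul (b 1) (b 1) = 0 ∧
      P.mul (b 1) (b 2) = l • b 1 ∧ P.mul (b 2) (b 2) = n • b 2 ∧
      m ^ 2 + r * l = 0 ∧ s * l = 0 ∧ n * l = l ^ 2 ∧ 2 * m * s + r * n = l * r + s ^ 2 := by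
  have h10 : P.bracket (b 1) (b 0) = -b 1 := by rw [P.bracket_skew, h01]
  have h20 : P.bracket (b 2) (b 0) = 0 := by rw [P.bracket_skew, h02, neg_zero]
  have h21 : P.bracket (b 2) (b 1) = 0 := by rw [P.bracket_skew, h12, neg_zero]
  have H := P.leibniz_repr b
  simp [forall_fin_three_iff, Fin.sum_univ_three, h01, h02, h12, h10, h20, h21, P.bracket_self,
    P.mul_comm (b 1) (b 0), P.mul_comm (b 2) (b 0), P.mul_comm (b 2) (b 1)] at H
  have A := P.assoc_repr b 0 0 1 1
  have A2 := P.assoc_repr b 0 2 1 1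
  have A3 := P.assoc_repr b 2 2 1 1
  have A4 := P.assoc_repr b 0 0 2 2
  simp only [Fin.sum_univ_three, P.mul_comm (b 1) (b 0), P.mul_comm (b 2) (b 0),
    P.mul_comm (b 2) (b 1)] at A A2 A3 A4
  refine ⟨b.repr (P.mul (b 1) (b 2)) 1, b.repr (P.mul (b 0) (b 1)) 1, b.repr (P.mul (b 2) (b 2)) 2,
    b.repr (P.mul (b 0) (b 0)) 2, b.repr (P.mul (b 0) (b 2)) 2, ?_, ?_, ?_, ?_, ?_, ?_, ?_, ?_,
    ?_, ?_⟩
  · refine (eq_comb_of_repr b (x := 2 * b.repr (P.mul (b 0) (b 1)) 1)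
      (y := 0) ?_ ?_ rfl).trans (by simp) <;> grind
  · refine (eq_comb_of_repr b (x := 0) (z := 0) ?_ rfl ?_).trans (by simp) <;> grind
  · refine (eq_comb_of_repr b (x := b.repr (P.mul (b 1) (b 2)) 1)
      (y := 0) ?_ ?_ rfl).trans (by simp) <;> grind
  · refine eq_zero_of_repr b ?_ ?_ ?_ <;> grind
  · refine (eq_comb_of_repr b (x := 0) (z := 0) ?_ rfl ?_).trans (by simp) <;> grind
  · refine (eq_comb_of_repr b (x := 0) (y := 0) ?_ ?_ rfl).trans (by simp) <;> grind
  all_goals grind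

/-- The product is a nonzero binary quadratic form with values in the center. Two distinct isotropic
lines give the first family, and a double isotropic line gives the second. -/
theorem isIsomorphic_of_heisenberg_of_ne_zero (b : Module.Basis (Fin 3) ℂ V) {a g d : ℂ}
    (h01 : P.bracket (b 0) (b 1) = b 2) (h02 : P.bracket (b 0) (b 2) = 0)
    (h12 : P.bracket (b 1) (b 2) = 0) (m00 : P.mul (b 0) (b 0) = a • b 2)
    (m01 : P.mul (b 0) (b 1) = g • b 2) (m02 : P.mul (b 0) (b 2) = 0)
    (m11 : P.mul (b 1) (b 1) = d • b 2) (m12 : P.mul (b 1) (b 2) = 0)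
    (m22 : P.mul (b 2) (b 2) = 0) (ha : a ≠ 0) :
    (∃ γ : ℂ, P.IsIsomorphic (P31 γ)) ∨ P.IsIsomorphic P32 := by
  have h10 : P.bracket (b 1) (b 0) = -b 2 := by rw [P.bracket_skew, h01]
  have m10 : P.mul (b 1) (b 0) = g • b 2 := by rw [P.mul_comm, m01]
  -- A root `t` makes `t • b 0 + b 1` isotropic; it is a double root exactly when `a * t + g = 0`.
  obtain ⟨t, ht⟩ := Complex.exists_quadratic_root (2 * g / a) (d / a)
  have ht' : a * t ^ 2 + 2 * g * t + d = 0 := by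
    field_simp at ht
    linear_combination ht
  by_cases hroot : a * t + g = 0
  · right
    rw [isIsomorphic_P32_iff]
    -- The second vector spans the kernel of the form, scaled by `a` so that `{f 0, f 1}` equals `f
    -- 0 • f 0`.
    obtain ⟨f, f0, f1, f2⟩ := exists_basis_of_vectors b 1 0 0 (a * t) a 0 0 0 a (by simpa using ha)
    have hg : g = -(a * t) := by linear_combination hroot
    subst hg
    have hd : d = a * t ^ 2 := by linear_combination ht'
    subst hd
    refine ⟨f, ⟨?_, ?_, ?_⟩, ?_, ?_, ?_, ?_, ?_, ?_⟩ <;>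
      simp [f0, f1, f2, h01, h02, h12, h10, m00, m01, m02, m11, m12, m22, m10, P.bracket_self]
    all_goals match_scalars <;> ring
  · left
    have hdet : 2 * (a * t + g) / a ≠ 0 := div_ne_zero (mul_ne_zero two_ne_zero hroot) ha
    -- By Vieta this is the other root. The isotropic vectors for the two roots have bracket `(t -
    -- u) • b 2`, and `γ` is their product measured in that unit.
    have hu : a * (-(2 * g / a) - t) ^ 2 + 2 * g * (-(2 * g / a) - t) + d = 0 := by
      field_simp
      linear_combination a * ht'
    obtain ⟨u, hut⟩ : ∃ u, u = -(2 * g / a) - t := ⟨_, rfl⟩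
    rw [← hut] at hu
    have hne : t - u ≠ 0 := by
      rw [hut]
      convert hdet using 1
      field_simp
      ring
    obtain ⟨f, f0, f1, f2⟩ := exists_basis_of_vectors b t 1 0 u 1 0 0 0 (t - u)
      (by simpa [← sub_mul] using hne)
    refine ⟨(a * (t * u) + g * (t + u) + d) / (t - u), ?_⟩
    rw [isIsomorphic_P31_iff]
    refine ⟨f, ⟨?_, ?_, ?_⟩, ?_, ?_, ?_, ?_, ?_, ?_⟩ <;>
      simp [f0, f1, f2, h01, h02, h12, h10, m00, m01, m02, m11, m12, m22, m10, P.bracket_self]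
    · module
    · match_scalars
      linear_combination ht'
    · match_scalars
      field_simp
      ring
    · match_scalars
      linear_combination hu

theorem isHeisenberg_iff_isIsomorphic : IsHeisenberg P.LiePart ↔
    (∃ γ : ℂ, P.IsIsomorphic (P31 γ)) ∨ P.IsIsomorphic P32 := by
  rw [IsHeisenberg, hasBasisWithBrackets_iff]
  constructor
  · rintro ⟨b, h01, h02, h12⟩
    simp only [zero_smul, one_smul, zero_add] at h01 h02
    obtain ⟨a, g, d, m00, m01, m02, m11, m12, m22⟩ := P.exists_mul_of_heisenberg b h01 h02 h12
    by_cases ha : a = 0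
    · by_cases hd : d = 0
      · subst ha hd
        left
        refine ⟨g, (P.isIsomorphic_P31_iff g).2 ⟨b, ⟨h01, h02, h12⟩, ?_⟩⟩
        simp [m00, m01, m02, m11, m12, m22]
      -- The basis `b 1, -b 0, b 2` keeps the brackets and exchanges `a` with `d`.
      · obtain ⟨f, f0, f1, f2⟩ := exists_basis_of_vectors b 0 1 0 (-1) 0 0 0 0 1 (by simp)
        have h10 : P.bracket (b 1) (b 0) = -b 2 := by rw [P.bracket_skew, h01]
        have m10 : P.mul (b 1) (b 0) = g • b 2 := by rw [P.mul_comm, m01]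
        refine P.isIsomorphic_of_heisenberg_of_ne_zero f (a := d) (g := -g) (d := a)
          ?_ ?_ ?_ ?_ ?_ ?_ ?_ ?_ ?_ hd <;>
          simp [f0, f1, f2, h01, h02, h12, h10, m00, m01, m02, m11, m12, m22, m10]
    · exact P.isIsomorphic_of_heisenberg_of_ne_zero b h01 h02 h12 m00 m01 m02 m11 m12 m22 ha
  · rintro (⟨γ, h⟩ | h)
    · obtain ⟨b, ⟨h01, h02, h12⟩, -⟩ := (P.isIsomorphic_P31_iff γ).1 h
      exact ⟨b, by simp [h01], by simp [h02], h12⟩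
    · obtain ⟨b, ⟨h01, h02, h12⟩, -⟩ := P.isIsomorphic_P32_iff.1 h
      exact ⟨b, by simp [h01], by simp [h02], h12⟩

theorem hasBasisWithBrackets_affine_iff_isIsomorphic :
    HasBasisWithBrackets P.LiePart 1 0 0 0 ↔
      (∃ α : ℂ, P.IsIsomorphic (P33 α)) ∨ P.IsIsomorphic P34 ∨ P.IsIsomorphic P35 ∨
        P.IsIsomorphic P36 := by
  rw [hasBasisWithBrackets_iff]
  constructor
  · rintro ⟨b, h01, h02, h12⟩
    simp only [zero_smul, one_smul, add_zero] at h01 h02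
    obtain ⟨l, m, n, r, s, m00, m01, m02, m11, m12, m22, e1, e2, e3, e4⟩ :=
      P.exists_mul_of_affine b h01 h02 h12
    have h21 : P.bracket (b 2) (b 1) = 0 := by rw [P.bracket_skew, h12, neg_zero]
    have h20 : P.bracket (b 2) (b 0) = 0 := by rw [P.bracket_skew, h02, neg_zero]
    have m20 : P.mul (b 2) (b 0) = l • b 0 + s • b 2 := by rw [P.mul_comm, m02]
    have m21 : P.mul (b 2) (b 1) = l • b 1 := by rw [P.mul_comm, m12]
    by_cases hl : l = 0
    · subst hl
      have hm : m = 0 := by simpa using e1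
      subst hm
      by_cases hn : n = 0
      · subst hn
        have hs : s = 0 := pow_eq_zero_iff two_ne_zero |>.1 (by simpa using e4.symm)
        subst hs
        by_cases hr : r = 0
        · subst hr
          right; right; left
          refine P.isIsomorphic_P35_iff.2 ⟨b, ⟨h01, h02, h12⟩, ?_⟩
          simp [m00, m01, m02, m11, m12, m22]
        · right; left
          obtain ⟨f, f0, f1, f2⟩ := exists_basis_of_vectors b 1 0 0 0 1 0 0 0 r (by simpa using hr)
          refine P.isIsomorphic_P34_iff.2 ⟨f, ?_⟩
          simp [f0, f1, f2, h01, h02, h12, m00, m01, m02, m11, m12, m22]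
      · left
        -- Rescaling makes the central vector idempotent; the last relation then reads `r * n = s ^
        -- 2`.
        obtain ⟨f, f0, f1, f2⟩ := exists_basis_of_vectors b 1 0 0 0 1 0 0 0 n⁻¹ (by simpa using hn)
        refine ⟨s, (P.isIsomorphic_P33_iff s).2 ⟨f, ?_⟩⟩
        have hr : r = s ^ 2 * n⁻¹ := by
          field_simp
          linear_combination e4
        simp [f0, f1, f2, h01, h02, h12, m00, m01, m02, m11, m12, m22, smul_smul, hn, hr,
          _root_.mul_comm]
    · right; right; right
      have hs : s = 0 := (mul_eq_zero.1 e2).resolve_right hl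
      have hn : n = l := mul_right_cancel₀ hl (by linear_combination e3)
      subst hs hn
      have hr : r = -(m ^ 2) / n := by
        field_simp
        linear_combination e1
      subst hr
      -- The rescaled central vector is a unit, and the correction of `b 0` by a central multiple
      -- makes its square zero.
      obtain ⟨f, f0, f1, f2⟩ := exists_basis_of_vectors b 1 0 (-(m / n)) 0 1 0 0 0 n⁻¹
        (by simpa using hl)
      refine P.isIsomorphic_P36_iff.2 ⟨f, ⟨?_, ?_, ?_⟩, ?_, ?_, ?_, ?_, ?_, ?_⟩ <;>
        simp [f0, f1, f2, h01, h02, h12, h20, h21, m00, m01, m02, m11, m12, m22, m20, m21,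
          P.bracket_self, hl]
      all_goals match_scalars <;> field_simp <;> ring
  · rintro (⟨α, h⟩ | h | h | h)
    · obtain ⟨b, ⟨h01, h02, h12⟩, -⟩ := (P.isIsomorphic_P33_iff α).1 h
      exact ⟨b, by simp [h01], by simp [h02], h12⟩
    · obtain ⟨b, ⟨h01, h02, h12⟩, -⟩ := P.isIsomorphic_P34_iff.1 h
      exact ⟨b, by simp [h01], by simp [h02], h12⟩
    · obtain ⟨b, ⟨h01, h02, h12⟩, -⟩ := P.isIsomorphic_P35_iff.1 h
      exact ⟨b, by simp [h01], by simp [h02], h12⟩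
    · obtain ⟨b, ⟨h01, h02, h12⟩, -⟩ := P.isIsomorphic_P36_iff.1 h
      exact ⟨b, by simp [h01], by simp [h02], h12⟩

/-- The product is forced to be zero, so the same basis serves both sides. -/
theorem hasBasisWithBrackets_diagonal_iff_isIsomorphic {α : ℂ} (hα : α ≠ 0) :
    HasBasisWithBrackets P.LiePart 1 0 0 α ↔ P.IsIsomorphic (P37 α) := by
  rw [hasBasisWithBrackets_iff, isIsomorphic_P37_iff]
  refine exists_congr fun b => ?_
  simp only [zero_smul, one_smul, add_zero, zero_add]
  exact ⟨fun h => ⟨h, P.mul_eq_zero_of_solvable b (β := 0) hα (by simpa using h.1) h.2.1 h.2.2⟩,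
    fun h => h.1⟩

theorem hasBasisWithBrackets_jordan_iff_isIsomorphic :
    HasBasisWithBrackets P.LiePart 1 1 0 1 ↔ P.IsIsomorphic P38 := by
  rw [hasBasisWithBrackets_iff, isIsomorphic_P38_iff]
  refine exists_congr fun b => ?_
  simp only [zero_smul, one_smul, add_zero, zero_add]
  exact ⟨fun h => ⟨h, P.mul_eq_zero_of_solvable b (β := 1) one_ne_zero (by simpa using h.1)
    (by simpa using h.2.1) h.2.2⟩, fun h => h.1⟩

theorem hasSl2Basis_iff_isIsomorphic : HasSl2Basis P.LiePart ↔ P.IsIsomorphic P39 := by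
  rw [hasSl2Basis_iff, isIsomorphic_P39_iff]
  exact exists_congr fun b =>
    ⟨fun h => ⟨h, P.mul_eq_zero_of_sl2 b h.1 h.2.1 h.2.2⟩, fun h => h.1⟩

end Products

end PoissonStructure

namespace PoissonStructure

/-! ### Invariants that separate the nine families. -/

section Invariants

variable {V : Type*} [AddCommGroup V] [Module ℂ V] (P : PoissonStructure ℂ V)

/-- The Lie bracket is nilpotent of class at most two. -/
def IsTwoStepNilpotent : Prop := ∀ X Y Z, P.bracket X (P.bracket Y Z) = 0

/-- The Lie bracket is solvable of length at most two. -/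
def IsMetabelian : Prop := ∀ X Y Z W, P.bracket (P.bracket X Y) (P.bracket Z W) = 0

/-- The Lie algebra has a nonzero central element. -/
def HasCenter : Prop := ∃ X, X ≠ 0 ∧ ∀ Y, P.bracket X Y = 0

/-- The operator `{X, · }` has two linearly independent eigenvectors with nonzero eigenvalues. -/
def HasEigenPair : Prop := ∃ (X Y Z : V) (s t : ℂ), s ≠ 0 ∧ t ≠ 0 ∧ P.bracket X Y = s • Y ∧
  P.bracket X Z = t • Z ∧ ∀ u v : ℂ, u • Y + v • Z = 0 → u = 0 ∧ v = 0

/-- The product is not zero. -/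
def HasNonzeroMul : Prop := ∃ X Y, P.mul X Y ≠ 0

/-- The product is not zero and is annihilated by an element that is not central. -/
def HasNoncentralAnnihilator : Prop :=
  P.HasNonzeroMul ∧ ∃ X, (∀ Y, P.mul X Y = 0) ∧ ∃ Y, P.bracket X Y ≠ 0

/-- The product has a nonzero idempotent. -/
def HasIdempotent : Prop := ∃ X, X ≠ 0 ∧ P.mul X X = X

/-- The product has a unit. -/
def HasUnit : Prop := ∃ X, ∀ Y, P.mul X Y = Y

/-- A property that the algebras of the `k`-th family have, and those of the other families do
not have. -/
def FamilyProperty : Fin 9 → Prop :=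
  ![P.IsMetabelian ∧ P.IsTwoStepNilpotent ∧ ¬ P.HasNoncentralAnnihilator,
    P.IsMetabelian ∧ P.IsTwoStepNilpotent ∧ P.HasNoncentralAnnihilator,
    P.IsMetabelian ∧ ¬ P.IsTwoStepNilpotent ∧ P.HasCenter ∧ P.HasIdempotent ∧ ¬ P.HasUnit,
    P.IsMetabelian ∧ ¬ P.IsTwoStepNilpotent ∧ P.HasCenter ∧ ¬ P.HasIdempotent ∧ P.HasNonzeroMul ∧
      ¬ P.HasUnit,
    P.IsMetabelian ∧ ¬ P.IsTwoStepNilpotent ∧ P.HasCenter ∧ ¬ P.HasIdempotent ∧ ¬ P.HasNonzeroMul ∧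
      ¬ P.HasUnit,
    P.IsMetabelian ∧ ¬ P.IsTwoStepNilpotent ∧ P.HasCenter ∧ P.HasUnit,
    P.IsMetabelian ∧ ¬ P.IsTwoStepNilpotent ∧ ¬ P.HasCenter ∧ P.HasEigenPair,
    P.IsMetabelian ∧ ¬ P.IsTwoStepNilpotent ∧ ¬ P.HasCenter ∧ ¬ P.HasEigenPair,
    ¬ P.IsMetabelian]

theorem FamilyProperty.unique {k l : Fin 9} (hk : P.FamilyProperty k) (hl : P.FamilyProperty l) :
    k = l := by
  fin_cases k <;> fin_cases l <;> first | rfl | (exfalso; simp [FamilyProperty] at hk hl; tauto)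

theorem isMetabelian_of_hasBasisWithBrackets {x₂ x₃ y₂ y₃ : ℂ}
    (h : HasBasisWithBrackets P.LiePart x₂ x₃ y₂ y₃) : P.IsMetabelian :=
  h.lie_lie_lie_eq_zero

theorem isTwoStepNilpotent_of_isHeisenberg (h : IsHeisenberg P.LiePart) : P.IsTwoStepNilpotent :=
  h.lie_lie_eq_zero

theorem not_isTwoStepNilpotent_of_bracket_eq_self {X Y : V} (h : P.bracket X Y = Y) (hY : Y ≠ 0) :
    ¬ P.IsTwoStepNilpotent := fun hn => hY (by simpa [h] using hn X X Y)

theorem familyProperty_P31 {γ : ℂ} (h : P.IsIsomorphic (P31 γ)) : P.FamilyProperty 0 := by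
  have hH := P.isHeisenberg_iff_isIsomorphic.2 (Or.inl ⟨γ, h⟩)
  refine ⟨P.isMetabelian_of_hasBasisWithBrackets hH, P.isTwoStepNilpotent_of_isHeisenberg hH, ?_⟩
  obtain ⟨b, ⟨h01, h02, h12⟩, m00, m01, m02, m11, m12, m22⟩ := (P.isIsomorphic_P31_iff γ).1 h
  have m10 : P.mul (b 1) (b 0) = γ • b 2 := by rw [P.mul_comm, m01]
  have m20 : P.mul (b 2) (b 0) = 0 := by rw [P.mul_comm, m02]
  have m21 : P.mul (b 2) (b 1) = 0 := by rw [P.mul_comm, m12]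
  have h20 : P.bracket (b 2) (b 0) = 0 := by rw [P.bracket_skew, h02, neg_zero]
  have h21 : P.bracket (b 2) (b 1) = 0 := by rw [P.bracket_skew, h12, neg_zero]
  rintro ⟨⟨Z, W, hZW⟩, X, hX, Y, hXY⟩
  -- For `γ = 0` the product vanishes. For `γ ≠ 0` its annihilator is the line of `b 2`, which is
  -- central.
  have hγ : γ ≠ 0 := by
    rintro rfl
    obtain ⟨z₀, z₁, z₂, rfl⟩ := basis_expand b Z
    obtain ⟨w₀, w₁, w₂, rfl⟩ := basis_expand b W
    simp [m00, m01, m02, m11, m12, m22, m10, m20, m21] at hZW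
  obtain ⟨x₀, x₁, x₂, rfl⟩ := basis_expand b X
  obtain ⟨y₀, y₁, y₂, rfl⟩ := basis_expand b Y
  have e0 := hX (b 0)
  have e1 := hX (b 1)
  simp [m00, m01, m02, m11, m12, m22, m10, m20, m21, hγ, b.ne_zero] at e0 e1
  simp [e0, e1, h20, h21, P.bracket_self] at hXY

theorem familyProperty_P32 (h : P.IsIsomorphic P32) : P.FamilyProperty 1 := by
  have hH := P.isHeisenberg_iff_isIsomorphic.2 (Or.inr h)
  refine ⟨P.isMetabelian_of_hasBasisWithBrackets hH, P.isTwoStepNilpotent_of_isHeisenberg hH, ?_⟩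
  obtain ⟨b, ⟨h01, h02, h12⟩, m00, m01, m02, m11, m12, m22⟩ := P.isIsomorphic_P32_iff.1 h
  have m10 : P.mul (b 1) (b 0) = 0 := by rw [P.mul_comm, m01]
  refine ⟨⟨b 0, b 0, by simp [m00, b.ne_zero]⟩, b 1, fun Y => ?_, b 0, ?_⟩
  · obtain ⟨y₀, y₁, y₂, rfl⟩ := basis_expand b Y
    simp [m10, m11, m12]
  · rw [P.bracket_skew, h01]
    simp [b.ne_zero]

theorem affine_invariants (b : Module.Basis (Fin 3) ℂ V)
    (h01 : P.bracket (b 0) (b 1) = b 1) (h02 : P.bracket (b 0) (b 2) = 0)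
    (h12 : P.bracket (b 1) (b 2) = 0) :
    P.IsMetabelian ∧ ¬ P.IsTwoStepNilpotent ∧ P.HasCenter := by
  have h20 : P.bracket (b 2) (b 0) = 0 := by rw [P.bracket_skew, h02, neg_zero]
  have h21 : P.bracket (b 2) (b 1) = 0 := by rw [P.bracket_skew, h12, neg_zero]
  refine ⟨P.isMetabelian_of_hasBasisWithBrackets ((P.hasBasisWithBrackets_iff 1 0 0 0).2
    ⟨b, by simpa using h01, by simpa using h02, h12⟩),
    P.not_isTwoStepNilpotent_of_bracket_eq_self h01 (b.ne_zero 1), b 2, b.ne_zero 2, fun Y => ?_⟩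
  obtain ⟨y₀, y₁, y₂, rfl⟩ := basis_expand b Y
  simp [h20, h21, P.bracket_self]

theorem not_hasUnit_of_annihilator {X : V} (hX : X ≠ 0) (h : ∀ Y, P.mul X Y = 0) :
    ¬ P.HasUnit := by
  rintro ⟨u, hu⟩
  exact hX (by rw [← hu X, P.mul_comm, h])

theorem familyProperty_P33 {α : ℂ} (h : P.IsIsomorphic (P33 α)) : P.FamilyProperty 2 := by
  obtain ⟨b, ⟨h01, h02, h12⟩, m00, m01, m02, m11, m12, m22⟩ := (P.isIsomorphic_P33_iff α).1 h
  obtain ⟨i1, i2, i3⟩ := P.affine_invariants b h01 h02 h12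
  have m10 : P.mul (b 1) (b 0) = 0 := by rw [P.mul_comm, m01]
  refine ⟨i1, i2, i3, ⟨b 2, b.ne_zero 2, m22⟩, ?_⟩
  refine P.not_hasUnit_of_annihilator (b.ne_zero 1) fun Y => ?_
  obtain ⟨y₀, y₁, y₂, rfl⟩ := basis_expand b Y
  simp [m10, m11, m12]

theorem familyProperty_P34 (h : P.IsIsomorphic P34) : P.FamilyProperty 3 := by
  obtain ⟨b, ⟨h01, h02, h12⟩, m00, m01, m02, m11, m12, m22⟩ := P.isIsomorphic_P34_iff.1 h
  obtain ⟨i1, i2, i3⟩ := P.affine_invariants b h01 h02 h12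
  have m10 : P.mul (b 1) (b 0) = 0 := by rw [P.mul_comm, m01]
  have m20 : P.mul (b 2) (b 0) = 0 := by rw [P.mul_comm, m02]
  have m21 : P.mul (b 2) (b 1) = 0 := by rw [P.mul_comm, m12]
  refine ⟨i1, i2, i3, ?_, ⟨b 0, b 0, by simp [m00, b.ne_zero]⟩, ?_⟩
  · rintro ⟨X, hX, hXX⟩
    obtain ⟨x₀, x₁, x₂, rfl⟩ := basis_expand b X
    obtain ⟨e0, e1, e2⟩ := basis_comb_inj b (a₀ := 0) (a₁ := 0) (a₂ := x₀ * x₀) (by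
      rw [← hXX]
      simp [m00, m01, m02, m11, m12, m22, m10, m20, m21, smul_smul])
    subst e0 e1
    simp [← e2] at hX
  · refine P.not_hasUnit_of_annihilator (b.ne_zero 1) fun Y => ?_
    obtain ⟨y₀, y₁, y₂, rfl⟩ := basis_expand b Y
    simp [m10, m11, m12]

theorem familyProperty_P35 (h : P.IsIsomorphic P35) : P.FamilyProperty 4 := by
  obtain ⟨b, ⟨h01, h02, h12⟩, m00, m01, m02, m11, m12, m22⟩ := P.isIsomorphic_P35_iff.1 h
  obtain ⟨i1, i2, i3⟩ := P.affine_invariants b h01 h02 h12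
  have m10 : P.mul (b 1) (b 0) = 0 := by rw [P.mul_comm, m01]
  have m20 : P.mul (b 2) (b 0) = 0 := by rw [P.mul_comm, m02]
  have m21 : P.mul (b 2) (b 1) = 0 := by rw [P.mul_comm, m12]
  have hmul : ∀ X Y, P.mul X Y = 0 := by
    intro X Y
    obtain ⟨x₀, x₁, x₂, rfl⟩ := basis_expand b X
    obtain ⟨y₀, y₁, y₂, rfl⟩ := basis_expand b Y
    simp [m00, m01, m02, m11, m12, m22, m10, m20, m21]
  refine ⟨i1, i2, i3, ?_, ?_, P.not_hasUnit_of_annihilator (b.ne_zero 0) (hmul _)⟩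
  · rintro ⟨X, hX, hXX⟩
    exact hX (by rw [← hXX, hmul])
  · rintro ⟨X, Y, hXY⟩
    exact hXY (hmul X Y)

theorem familyProperty_P36 (h : P.IsIsomorphic P36) : P.FamilyProperty 5 := by
  obtain ⟨b, ⟨h01, h02, h12⟩, m00, m01, m02, m11, m12, m22⟩ := P.isIsomorphic_P36_iff.1 h
  obtain ⟨i1, i2, i3⟩ := P.affine_invariants b h01 h02 h12
  have m20 : P.mul (b 2) (b 0) = b 0 := by rw [P.mul_comm, m02]
  have m21 : P.mul (b 2) (b 1) = b 1 := by rw [P.mul_comm, m12]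
  refine ⟨i1, i2, i3, b 2, fun Y => ?_⟩
  obtain ⟨y₀, y₁, y₂, rfl⟩ := basis_expand b Y
  simp [m20, m21, m22]

/-- For a central element, the bracket with `b 2` removes the `b 0` component; `b 0` acts invertibly
on the span of the other two. -/
theorem not_hasCenter_of_solvable (b : Module.Basis (Fin 3) ℂ V) {α β : ℂ} (hα : α ≠ 0)
    (h01 : P.bracket (b 0) (b 1) = b 1 + β • b 2) (h02 : P.bracket (b 0) (b 2) = α • b 2)
    (h12 : P.bracket (b 1) (b 2) = 0) : ¬ P.HasCenter := by
  have h10 : P.bracket (b 1) (b 0) = -(b 1 + β • b 2) := by rw [P.bracket_skew, h01]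
  have h20 : P.bracket (b 2) (b 0) = -(α • b 2) := by rw [P.bracket_skew, h02]
  rintro ⟨X, hX, hc⟩
  obtain ⟨x₀, x₁, x₂, rfl⟩ := basis_expand b X
  have e0 := hc (b 0)
  have e2 := hc (b 2)
  simp [h02, h12, hα, b.ne_zero, P.bracket_self] at e2
  subst e2
  obtain ⟨-, f1, f2⟩ := basis_comb_eq_zero b (a₀ := 0) (a₁ := -x₁) (a₂ := -(x₁ * β + x₂ * α)) (by
    rw [← e0]
    simp [h10, h20, P.bracket_self]
    module)
  have hx1 : x₁ = 0 := neg_eq_zero.1 f1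
  subst hx1
  simp [hα] at f2
  subst f2
  simp at hX

theorem familyProperty_P37 {α : ℂ} (hα : α ≠ 0) (h : P.IsIsomorphic (P37 α)) :
    P.FamilyProperty 6 := by
  refine ⟨P.isMetabelian_of_hasBasisWithBrackets
    ((P.hasBasisWithBrackets_diagonal_iff_isIsomorphic hα).2 h), ?_⟩
  obtain ⟨b, ⟨h01, h02, h12⟩, -⟩ := (P.isIsomorphic_P37_iff α).1 h
  refine ⟨P.not_isTwoStepNilpotent_of_bracket_eq_self h01 (b.ne_zero 1),
    P.not_hasCenter_of_solvable b (β := 0) hα (by simpa using h01) h02 h12,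
    b 0, b 1, b 2, 1, α, one_ne_zero, hα, by simpa using h01, h02, fun u v huv => ?_⟩
  exact (basis_comb_eq_zero b (a₀ := 0) (by simpa using huv)).2

theorem familyProperty_P38 (h : P.IsIsomorphic P38) : P.FamilyProperty 7 := by
  refine ⟨P.isMetabelian_of_hasBasisWithBrackets
    (P.hasBasisWithBrackets_jordan_iff_isIsomorphic.2 h), ?_⟩
  obtain ⟨b, ⟨h01, h02, h12⟩, -⟩ := P.isIsomorphic_P38_iff.1 h
  have h10 : P.bracket (b 1) (b 0) = -(b 1 + b 2) := by rw [P.bracket_skew, h01]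
  have h20 : P.bracket (b 2) (b 0) = -b 2 := by rw [P.bracket_skew, h02]
  have h21 : P.bracket (b 2) (b 1) = 0 := by rw [P.bracket_skew, h12, neg_zero]
  refine ⟨P.not_isTwoStepNilpotent_of_bracket_eq_self h02 (b.ne_zero 2),
    P.not_hasCenter_of_solvable b (α := 1) (β := 1) one_ne_zero (by simpa using h01)
      (by simpa using h02) h12, ?_⟩
  rintro ⟨X, Y, Z, s, t, hs, ht, hY, hZ, hYZ⟩
  obtain ⟨x₀, x₁, x₂, rfl⟩ := basis_expand b X
  -- An eigenvector for `c ≠ 0` lies in the image, hence in the span of `b 1` and `b 2`. There the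
  -- action is a multiple of a Jordan block, whose only eigenline is that of `b 2`.
  have key : ∀ (W : V) (c : ℂ), c ≠ 0 →
      P.bracket (x₀ • b 0 + x₁ • b 1 + x₂ • b 2) W = c • W → ∃ w : ℂ, W = w • b 2 := by
    intro W c hc hW
    obtain ⟨w₀, w₁, w₂, rfl⟩ := basis_expand b W
    obtain ⟨e0, e1, e2⟩ := basis_comb_inj b (a₀ := 0) (a₁ := x₀ * w₁ - x₁ * w₀)
      (a₂ := (x₀ * w₁ - x₁ * w₀) + (x₀ * w₂ - x₂ * w₀)) (c₀ := c * w₀) (c₁ := c * w₁)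
      (c₂ := c * w₂) (by
        refine Eq.trans ?_ (hW.trans ?_)
        · simp [h01, h02, h12, h10, h20, h21, P.bracket_self]
          module
        · module)
    have hw0 : w₀ = 0 := by simpa [hc] using e0.symm
    subst hw0
    have hw1 : w₁ = 0 := by
      by_contra hw1
      have hxc : x₀ = c := mul_right_cancel₀ hw1 (by linear_combination e1)
      subst hxc
      have : x₀ * w₁ = 0 := by linear_combination e2
      exact (mul_ne_zero hc hw1) this
    subst hw1
    exact ⟨w₂, by simp⟩
  obtain ⟨y, rfl⟩ := key Y s hs hY
  obtain ⟨z, rfl⟩ := key Z t ht hZ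
  obtain ⟨hz, hy⟩ := hYZ z (-y) (by module)
  have := (hYZ 1 1 (by rw [hz, neg_eq_zero.1 hy]; simp)).1
  exact one_ne_zero this

theorem familyProperty_P39 (h : P.IsIsomorphic P39) : P.FamilyProperty 8 := by
  obtain ⟨b, ⟨h01, h02, h12⟩, -⟩ := P.isIsomorphic_P39_iff.1 h
  intro hm
  have := hm (b 0) (b 1) (b 0) (b 2)
  simp [h01, h02, h12, b.ne_zero] at this

theorem familyProperty_of_isIsomorphic {k : Fin 9} {Q : PoissonStructure ℂ (Fin 3 → ℂ)}
    (hQ : Q ∈ family k) (h : P.IsIsomorphic Q) : P.FamilyProperty k := by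
  fin_cases k
  · obtain ⟨γ, rfl⟩ := hQ
    exact P.familyProperty_P31 h
  · obtain rfl := hQ
    exact P.familyProperty_P32 h
  · obtain ⟨α, rfl⟩ := hQ
    exact P.familyProperty_P33 h
  · obtain rfl := hQ
    exact P.familyProperty_P34 h
  · obtain rfl := hQ
    exact P.familyProperty_P35 h
  · obtain rfl := hQ
    exact P.familyProperty_P36 h
  · obtain ⟨α, hα, rfl⟩ := hQ
    exact P.familyProperty_P37 hα h
  · obtain rfl := hQ
    exact P.familyProperty_P38 h
  · obtain rfl := hQ
    exact P.familyProperty_P39 h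

theorem exists_family_of_not_isLieAbelian (hV : Module.finrank ℂ V = 3)
    (hP : ¬ IsLieAbelian P.LiePart) : ∃ k : Fin 9, ∃ Q ∈ family k, P.IsIsomorphic Q := by
  have hV' : Module.finrank ℂ P.LiePart = 3 := hV
  rcases lie_classification hV' hP with (h | h | ⟨α, hα, h⟩ | h) | h
  · rcases P.isHeisenberg_iff_isIsomorphic.1 h with ⟨γ, h⟩ | h
    · exact ⟨0, _, ⟨γ, rfl⟩, h⟩
    · exact ⟨1, _, rfl, h⟩
  · rcases P.hasBasisWithBrackets_affine_iff_isIsomorphic.1 h with ⟨α, h⟩ | h | h | h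
    · exact ⟨2, _, ⟨α, rfl⟩, h⟩
    · exact ⟨3, _, rfl, h⟩
    · exact ⟨4, _, rfl, h⟩
    · exact ⟨5, _, rfl, h⟩
  · exact ⟨6, _, ⟨α, hα, rfl⟩, (P.hasBasisWithBrackets_diagonal_iff_isIsomorphic hα).1 h⟩
  · exact ⟨7, _, rfl, P.hasBasisWithBrackets_jordan_iff_isIsomorphic.1 h⟩
  · exact ⟨8, _, rfl, P.hasSl2Basis_iff_isIsomorphic.1 h⟩

theorem existsUnique_family (hV : Module.finrank ℂ V = 3) (hP : ¬ IsLieAbelian P.LiePart) :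
    ∃! k : Fin 9, ∃ Q ∈ family k, P.IsIsomorphic Q := by
  obtain ⟨k, Q, hQ, h⟩ := P.exists_family_of_not_isLieAbelian hV hP
  refine ⟨k, ⟨Q, hQ, h⟩, ?_⟩
  rintro l ⟨Q', hQ', h'⟩
  exact FamilyProperty.unique P (P.familyProperty_of_isIsomorphic hQ' h')
    (P.familyProperty_of_isIsomorphic hQ h)

end Invariants

/-! ### Zero bracket: commutative associative algebras. -/

section Abelian

variable {V W : Type*} [AddCommGroup V] [Module ℂ V] [AddCommGroup W] [Module ℂ W]

theorem bracket_eq_zero_of_isLieAbelian (P : PoissonStructure ℂ V) (hP : IsLieAbelian P.LiePart)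
    (X Y : V) : P.bracket X Y = 0 :=
  hP.trivial X Y

theorem prod_eq_mul_of_isLieAbelian (P : PoissonStructure ℂ V) (hP : IsLieAbelian P.LiePart)
    (X Y : V) : P.prod X Y = P.mul X Y := by
  simp [prod, P.bracket_eq_zero_of_isLieAbelian hP]

theorem isIsomorphic_iff_of_isLieAbelian (P : PoissonStructure ℂ V) (Q : PoissonStructure ℂ W)
    (hP : IsLieAbelian P.LiePart) (hQ : IsLieAbelian Q.LiePart) :
    P.IsIsomorphic Q ↔ ∃ e : P.AssocPart ≃ₗ[ℂ] Q.AssocPart, ∀ X Y, e (X * Y) = e X * e Y := by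
  constructor
  · rintro ⟨e, -, he⟩
    exact ⟨e, he⟩
  · rintro ⟨e, he⟩
    refine ⟨e, fun X Y => ?_, he⟩
    rw [P.bracket_eq_zero_of_isLieAbelian hP]
    exact (map_zero e).trans (Q.bracket_eq_zero_of_isLieAbelian hQ _ _).symm

/-- A commutative associative algebra as a Poisson algebra with zero bracket. -/
noncomputable def ofCommutative (A : Type*) [NonUnitalCommRing A] [Module ℂ A] [IsScalarTower ℂ A A]
    [SMulCommClass ℂ A A] : PoissonStructure ℂ A where
  bracket := 0
  mul := LinearMap.mul ℂ A
  bracket_self _ := rfl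
  jacobi _ _ _ := by simp
  mul_comm X Y := _root_.mul_comm X Y
  mul_assoc X Y Z := _root_.mul_assoc X Y Z
  leibniz _ _ _ := by simp

end Abelian

end PoissonStructure

theorem mainTheorem2 {V : Type*} [AddCommGroup V] [Module ℂ V] (hV : Module.finrank ℂ V = 3)
    (P : PoissonStructure ℂ V) :
    -- the classification when the Lie part is not abelian
    (¬ IsLieAbelian P.LiePart →
      ∃! k : Fin 9, ∃ Q ∈ PoissonStructure.family k, P.IsIsomorphic Q) ∧
    -- its organisation by the type of the Lie part
    (¬ IsLieAbelian P.LiePart →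
      LieRing.IsNilpotent P.LiePart ∨
      (LieAlgebra.IsSolvable P.LiePart ∧ ¬ LieRing.IsNilpotent P.LiePart) ∨
      LieAlgebra.IsSimple ℂ P.LiePart) ∧
    -- nilpotent, not abelian
    ((LieRing.IsNilpotent P.LiePart ∧ ¬ IsLieAbelian P.LiePart) ↔ IsHeisenberg P.LiePart) ∧
    (IsHeisenberg P.LiePart ↔
      (∃ γ : ℂ, P.IsIsomorphic (PoissonStructure.P31 γ)) ∨
      P.IsIsomorphic PoissonStructure.P32) ∧
    -- solvable, not nilpotent
    ((LieAlgebra.IsSolvable P.LiePart ∧ ¬ LieRing.IsNilpotent P.LiePart) ↔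
      HasBasisWithBrackets P.LiePart 1 0 0 0 ∨
      (∃ α : ℂ, α ≠ 0 ∧ HasBasisWithBrackets P.LiePart 1 0 0 α) ∨
      HasBasisWithBrackets P.LiePart 1 1 0 1) ∧
    (HasBasisWithBrackets P.LiePart 1 0 0 0 ↔
      (∃ α : ℂ, P.IsIsomorphic (PoissonStructure.P33 α)) ∨
      P.IsIsomorphic PoissonStructure.P34 ∨
      P.IsIsomorphic PoissonStructure.P35 ∨
      P.IsIsomorphic PoissonStructure.P36) ∧
    (∀ α : ℂ, α ≠ 0 →
      (HasBasisWithBrackets P.LiePart 1 0 0 α ↔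
        P.IsIsomorphic (PoissonStructure.P37 α))) ∧
    (HasBasisWithBrackets P.LiePart 1 1 0 1 ↔ P.IsIsomorphic PoissonStructure.P38) ∧
    -- simple
    (LieAlgebra.IsSimple ℂ P.LiePart ↔
      Nonempty (P.LiePart ≃ₗ⁅ℂ⁆ LieAlgebra.SpecialLinear.sl (Fin 2) ℂ)) ∧
    (Nonempty (P.LiePart ≃ₗ⁅ℂ⁆ LieAlgebra.SpecialLinear.sl (Fin 2) ℂ) ↔
      P.IsIsomorphic PoissonStructure.P39) ∧
    -- abelian Lie part: the problem is that of commutative associative algebras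
    (IsLieAbelian P.LiePart →
      (∀ X Y, P.prod X Y = P.mul X Y) ∧
      ∀ (W : Type*) [AddCommGroup W] [Module ℂ W] (Q : PoissonStructure ℂ W),
        IsLieAbelian Q.LiePart →
        (P.IsIsomorphic Q ↔
          ∃ e : P.AssocPart ≃ₗ[ℂ] Q.AssocPart, ∀ X Y, e (X * Y) = e X * e Y)) ∧
    (∀ (A : Type*) [NonUnitalCommRing A] [Module ℂ A] [IsScalarTower ℂ A A]
      [SMulCommClass ℂ A A], Module.finrank ℂ A = 3 →
      ∃ Q : PoissonStructure ℂ A, IsLieAbelian Q.LiePart ∧ ∀ a b, Q.mul a b = a * b) := by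
  have hV' : Module.finrank ℂ P.LiePart = 3 := hV
  refine ⟨P.existsUnique_family hV, fun hP => ?_, isNilpotent_and_not_isLieAbelian_iff hV',
    P.isHeisenberg_iff_isIsomorphic, isSolvable_and_not_isNilpotent_iff hV',
    P.hasBasisWithBrackets_affine_iff_isIsomorphic,
    fun α hα => P.hasBasisWithBrackets_diagonal_iff_isIsomorphic hα,
    P.hasBasisWithBrackets_jordan_iff_isIsomorphic,
    (isSimple_iff_hasSl2Basis hV').trans nonempty_lieEquiv_sl_iff.symm,
    nonempty_lieEquiv_sl_iff.trans P.hasSl2Basis_iff_isIsomorphic,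
    fun hP => ⟨P.prod_eq_mul_of_isLieAbelian hP, fun W _ _ Q hQ =>
      P.isIsomorphic_iff_of_isLieAbelian Q hP hQ⟩,
    fun A _ _ _ _ _ => ⟨PoissonStructure.ofCommutative A, ⟨fun _ _ => rfl⟩, fun _ _ => rfl⟩⟩
  rcases lie_classification hV' hP with (h | h) | h
  · exact Or.inl h.isNilpotent
  · exact Or.inr (Or.inl ((isSolvable_and_not_isNilpotent_iff hV').2 h))
  · exact Or.inr (Or.inr h.isSimple)
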